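/- **Conventions.** $A$ and $C$ are unital $C^*$-algebras, $B$ is a von Neumann algebra acting on a Hilbert space $H$, and $G$ is a locally compact group. Inner-product modules are right modules whose inner product is linear in the second variable; Hilbert modules are the complete ones. $\mathcal B^a(E,F)$ is the set of adjointable maps $E\to F$, $\mathcal B^a(F)=\mathcal B^a(F,F)$, and $B$ is a Hilbert $B$-module with $\langle b,c\rangle=b^*c$. A *von Neumann $B$-module* is an inner-product $B$-module $F$ which, via $x\mapsto L_x$, $L_x h=x\odot h$, is strongly closed in $\mathcal B(H,F\odot H)$, where $F\odot H$ is the interior tensor product; a *von Neumann $C$-$B$ module* is a von Neumann $B$-module $E'$ with a $*$-homomorphism $\rho:C\to\mathcal B^a(E')$ (not necessarily unital), written $cy=\rho(c)y$. A *unitary representation* of $G$ on an inner-product $B$-module $F$ is a group homomorphism $v$ from $G$ to the unitaries of $\mathcal B^a(F)$ such that $t\mapsto v_tf$ is norm continuous for all $f\in F$. **Data.** Let $E$ be a full Hilbert $A$-module, and let $\eta:G\to\mathrm{Aut}(E)$ be a dynamical system on $E$: a group homomorphism into the group of bijections $\Psi$ of $E$ such that for both $\Psi$ and $\Psi^{-1}$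 there is a $*$-homomorphism $\psi:A\to A$ with $\langle\Psi x,\Psi y\rangle=\psi(\langle x,y\rangle)$, with $t\mapsto\eta_t(x)$ continuous for all $x\in E$. Let $(G,\alpha^\eta,A)$ be the induced $C^*$-dynamical system, i.e. the unique one with $\alpha^\eta_t(\langle x,y\rangle)=\langle\eta_t(x),\eta_t(y)\rangle$. Let $E'$ be a von Neumann $C$-$B$ module. Let $u:G\to\mathcal U B$ and $u':G\to\mathcal U C$ be unitary representations, i.e. group homomorphisms such that $t\mapsto u_th$ is continuous for all $h\in H$, and $t\mapsto u'_ty$ is norm continuous for all $y\in E'$ (both hold if $u$ and $u'$ are norm continuous). Let $\tau:A\to B$ be a linear completely positive map, i.e. $\sum_{i,j}b_j^*\tau(a_j^*a_i)b_i\ge 0$ for all finite families. Let $T:E\to E'$ be a $\tau$-map, i.e. $\langle T(x),T(y)\rangle=\tau(\langle x,y\rangle)$, which is $(u',u)$-covariant, i.e. $T(\eta_t(x))=u'_tT(x)u_t^*$ for all $x\in E$, $t\in G$. **Theorem.** There exist (i) a von Neumann $B$-module $F$, a unital $*$-homomorphism $\pi:A\to\mathcal B^a(F)$, a unitary representation $v$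 of $G$ on $F$, and $V\in\mathcal B^a(B,F)$ such that * $\pi(\alpha^\eta_t(a))=v_t\pi(a)v_t^*$ for all $a\in A$, $t\in G$ (so $(\pi,v)$ is a covariant representation of $(G,\alpha^\eta,A)$), * $\tau(a)b=V^*\pi(a)Vb$ for all $a\in A$, $b\in B$, * $v_tVb=Vu_tb$ for all $t\in G$, $b\in B$; (ii) a von Neumann $B$-module $F'$, a map $\Psi:E\to\mathcal B^a(F,F')$, a unitary representation $w$ of $G$ on $F'$, and $S\in\mathcal B^a(E',F')$ such that * $\langle\Psi(y)f_1,\Psi(x)f_2\rangle=\langle\pi(\langle x,y\rangle)f_1,f_2\rangle$ for all $x,y\in E$, $f_1,f_2\in F$ (so $\Psi$ is a quasi-representation with which $\pi$ is associated), * $\Psi(\eta_t(x))=w_t\Psi(x)v_t^*$ for all $x\in E$, $t\in G$ (so $(\Psi,v,w,F,F')$ is a covariant quasi-representation of $(G,\eta,E)$), * $S$ is a coisometry from $E'$ onto $F'$, i.e. $SS^*=1_{F'}$, * $T(x)b=S^*\Psi(x)Vb$ for all $x\in E$, $b\in B$, * $w_tSy=Su'_ty$ for all $t\in G$, $y\in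 E'$. -/

import Mathlib

open scoped TensorProduct

universe uA uH uE uE' uC uG

noncomputable section

/-! ### Von Neumann algebras as C⋆-algebras

A von Neumann algebra `B` acting on `H` is Mathlib's `VonNeumannAlgebra H`; its elements form a
unital C⋆-algebra, with the order inherited from `B(H)`. -/

section VonNeumann

variable {H : Type*} [NormedAddCommGroup H] [InnerProductSpace ℂ H] [CompleteSpace H]

instance VonNeumannAlgebra.instSMulMemClass :
    SMulMemClass (VonNeumannAlgebra H) ℂ (H →L[ℂ] H) where
  smul_mem {s} c _ ha := s.toStarSubalgebra.smul_mem ha c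

instance VonNeumannAlgebra.instIsClosed (B : VonNeumannAlgebra H) :
    IsClosed (B : Set (H →L[ℂ] H)) := by
  rw [← B.centralizer_centralizer]
  exact Set.isClosed_centralizer _

instance VonNeumannAlgebra.instCStarAlgebra (B : VonNeumannAlgebra H) : CStarAlgebra B :=
  StarSubalgebra.cstarAlgebra B

instance VonNeumannAlgebra.instStarOrderedRing (B : VonNeumannAlgebra H) :
    StarOrderedRing B := by
  refine StarOrderedRing.of_nonneg_iff' ?_ ?_
  · intro x y hxy z
    change (z : H →L[ℂ] H) + x ≤ z + y
    gcongr
  · intro x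
    constructor
    · intro hx
      have hx' : (0 : H →L[ℂ] H) ≤ x := hx
      have hsa : IsSelfAdjoint (x : H →L[ℂ] H) := IsSelfAdjoint.of_nonneg hx'
      have hm : cfc Real.sqrt (x : H →L[ℂ] H) ∈ B.toStarSubalgebra :=
        cfc_mem (s := B.toStarSubalgebra) (hs := VonNeumannAlgebra.instIsClosed B) Real.sqrt x.2
      refine ⟨⟨_, hm⟩, Subtype.ext ?_⟩
      change (x : H →L[ℂ] H) = star (cfc Real.sqrt (x : H →L[ℂ] H)) * cfc Real.sqrt _
      have h1 : IsSelfAdjoint (cfc Real.sqrt (x : H →L[ℂ] H)) := cfc_predicate _ _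
      rw [h1.star_eq, ← cfc_mul _ _ _]
      conv_lhs => rw [← cfc_id ℝ (x : H →L[ℂ] H)]
      refine cfc_congr fun r hr => ?_
      exact (Real.mul_self_sqrt (spectrum_nonneg_of_nonneg hx' hr)).symm
    · rintro ⟨s, rfl⟩
      exact star_mul_self_nonneg (s : H →L[ℂ] H)

end VonNeumann

/-! ### Inner-product modules (pre-Hilbert C⋆-modules)

Right modules over `A` are encoded, as usual, as modules over `Aᵐᵒᵖ`; `MulOpposite.op a • x` is
`x a`. A Hilbert `A`-module is an inner-product `A`-module which is complete. -/

class ModuleInner (A : Type*) (E : Type*) where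
  /-- the `A`-valued inner product, linear in the second variable -/
  ip (A) : E → E → A


open ModuleInner MulOpposite

/-- The norm of `E` is required to be the one given by the inner product. Compatibility of the
complex scalars with the right action, `(c x) a = c (x a) = x (c a)`, follows from these axioms. -/
class InnerProductModule (A : Type*) (E : Type*) [CStarAlgebra A] [PartialOrder A]
    [NormedAddCommGroup E] [NormedSpace ℂ E] [Module Aᵐᵒᵖ E] extends ModuleInner A E where
  ip_add_right (x y z : E) : ip x (y + z) = ip x y + ip x z
  ip_smul_right (c : ℂ) (x y : E) : ip x (c • y) = c • ip x y
  ip_op_smul_right (a : A) (x y : E) : ip x (op a • y) = ip x y * a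
  star_ip (x y : E) : star (ip x y) = ip y x
  ip_self_nonneg (x : E) : 0 ≤ ip x x
  eq_zero_of_ip_self (x : E) : ip x x = 0 → x = 0
  norm_eq (x : E) : ‖x‖ = √‖ip x x‖

namespace InnerProductModule

variable {A : Type*} [CStarAlgebra A] [PartialOrder A]
variable {E : Type*} [NormedAddCommGroup E] [NormedSpace ℂ E] [Module Aᵐᵒᵖ E]
  [InnerProductModule A E]

theorem ip_add_left (x y z : E) : ip A (x + y) z = ip A x z + ip A y z := by
  rw [← star_ip, ip_add_right, star_add, star_ip, star_ip]

theorem ip_smul_left (c : ℂ) (x y : E) : ip A (c • x) y = star c • ip A x y := by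
  rw [← star_ip, ip_smul_right, star_smul, star_ip]

theorem ip_op_smul_left (a : A) (x y : E) : ip A (op a • x) y = star a * ip A x y := by
  rw [← star_ip, ip_op_smul_right, star_mul, star_ip]

theorem ip_zero_right (x : E) : ip A x 0 = 0 := by
  simpa using ip_smul_right (A := A) (0 : ℂ) x 0

theorem ip_zero_left (x : E) : ip A 0 x = 0 := by
  simpa using ip_smul_left (A := A) (0 : ℂ) 0 x

theorem ip_sub_right (x y z : E) : ip A x (y - z) = ip A x y - ip A x z := by
  have h := ip_smul_right (A := A) (-1 : ℂ) x z
  rw [neg_one_smul, neg_one_smul] at h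
  rw [sub_eq_add_neg, ip_add_right, h, sub_eq_add_neg]

theorem ip_sum_right {ι : Type*} (s : Finset ι) (x : E) (y : ι → E) :
    ip A x (∑ i ∈ s, y i) = ∑ i ∈ s, ip A x (y i) := by
  classical
  induction s using Finset.induction_on with
  | empty => simp [ip_zero_right]
  | insert i s hi ih => rw [Finset.sum_insert hi, Finset.sum_insert hi, ip_add_right, ih]

theorem ip_sum_left {ι : Type*} (s : Finset ι) (x : E) (y : ι → E) :
    ip A (∑ i ∈ s, y i) x = ∑ i ∈ s, ip A (y i) x := by
  rw [← star_ip, ip_sum_right, star_sum]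
  simp only [star_ip]

variable (A) in
theorem ext_left {x y : E} (h : ∀ z : E, ip A z x = ip A z y) : x = y := by
  refine sub_eq_zero.mp (eq_zero_of_ip_self (A := A) _ ?_)
  rw [ip_sub_right, h, sub_self]

variable (A) in
theorem ext_right {x y : E} (h : ∀ z : E, ip A x z = ip A y z) : x = y := by
  refine ext_left A fun z => ?_
  rw [← star_ip, h, star_ip]

/-- In a C⋆-algebra, an element compressing positively to its own negative part is positive; the
statement is phrased with explicit factorizations. -/
theorem exists_negPart_factor {M : Type*} [CStarAlgebra M] (G : M) (hG : IsSelfAdjoint G) :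
    ∃ N R : M, IsSelfAdjoint N ∧ N * G * N = -(star (R * N) * (R * N)) ∧
      (R * N = 0 → ∃ S, G = star S * S) := by
  let := CStarAlgebra.spectralOrder M
  have := CStarAlgebra.spectralOrderedRing M
  obtain ⟨R, hR⟩ := CStarAlgebra.nonneg_iff_eq_star_mul_self.mp (CFC.negPart_nonneg G)
  have hN : IsSelfAdjoint G⁻ := IsSelfAdjoint.of_nonneg (CFC.negPart_nonneg G)
  have hd := CFC.posPart_sub_negPart G hG
  refine ⟨G⁻, R, hN, ?_, fun h0 => ?_⟩
  · have h1 : G⁻ * G * G⁻ = -(G⁻ * G⁻ * G⁻) := by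
      have h2 : G⁻ * G = -(G⁻ * G⁻) := by
        have h3 : G⁻ * (G⁺ - G⁻) = -(G⁻ * G⁻) := by
          rw [mul_sub, CFC.negPart_mul_posPart, zero_sub]
        rwa [hd] at h3
      rw [h2, neg_mul]
    have h4 : star (R * G⁻) * (R * G⁻) = G⁻ * (star R * R) * G⁻ := by
      rw [star_mul, hN.star_eq]
      simp only [mul_assoc]
    rw [h1, h4, ← hR]
  · have h5 : star G⁻ * G⁻ = 0 := by
      rw [hN.star_eq]
      nth_rewrite 1 [hR]
      rw [mul_assoc, h0, mul_zero]
    have h6 : G⁻ = 0 := (CStarRing.star_mul_self_eq_zero_iff _).mp h5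
    rw [h6, sub_zero] at hd
    exact CStarAlgebra.nonneg_iff_eq_star_mul_self.mp (hd ▸ CFC.posPart_nonneg G)

/-- Gram matrices in an inner-product module are positive. -/
theorem exists_gram_factor [StarOrderedRing A] {n : Type*} [Fintype n] (x : n → E) :
    ∃ S : n → n → A, ∀ i j, ip A (x i) (x j) = ∑ k, star (S k i) * S k j := by
  classical
  let G : CStarMatrix n n A := CStarMatrix.ofMatrix (Matrix.of fun i j => ip A (x i) (x j))
  have hG : ∀ i j, G i j = ip A (x i) (x j) := fun i j => rfl
  have hsa : IsSelfAdjoint G := by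
    ext i j
    rw [CStarMatrix.star_apply, hG, hG, star_ip]
  obtain ⟨N, R, hN, hkey, hfac⟩ := exists_negPart_factor G hsa
  have hmul : ∀ (X Y : CStarMatrix n n A) (i j : n), (X * Y) i j = ∑ k, X i k * Y k j :=
    fun X Y i j => Matrix.mul_apply
  have hstar : ∀ (X : CStarMatrix n n A) (i j : n), (star X) i j = star (X j i) :=
    fun X i j => CStarMatrix.star_apply
  have hRN : R * N = 0 := by
    have h0 : ∀ k j, (R * N) j k = 0 := by
      intro k
      set y : E := ∑ i, op (N i k) • x i with hy
      have h1 : (N * G * N) k k = ip A y y := by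
        rw [hy, ip_sum_right, hmul]
        refine Finset.sum_congr rfl fun j _ => ?_
        rw [ip_op_smul_right, ip_sum_left, hmul]
        congr 1
        refine Finset.sum_congr rfl fun i _ => ?_
        rw [ip_op_smul_left, hG, ← hstar, hN.star_eq]
      have h2 : (N * G * N) k k = -∑ j, star ((R * N) j k) * (R * N) j k := by
        rw [hkey]
        change -((star (R * N) * (R * N)) k k) = _
        rw [hmul]
        simp only [hstar]
      have h3 : 0 ≤ -∑ j, star ((R * N) j k) * (R * N) j k := by
        rw [← h2, h1]
        exact ip_self_nonneg y
      have h4 : ∀ j ∈ Finset.univ, 0 ≤ star ((R * N) j k) * (R * N) j k :=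
        fun j _ => star_mul_self_nonneg _
      have h5 : ∑ j, star ((R * N) j k) * (R * N) j k = 0 :=
        le_antisymm (neg_nonneg.mp h3) (Finset.sum_nonneg h4)
      intro j
      have h6 := (Finset.sum_eq_zero_iff_of_nonneg h4).mp h5 j (Finset.mem_univ j)
      exact (CStarRing.star_mul_self_eq_zero_iff _).mp h6
    ext j k
    exact h0 k j
  obtain ⟨S, hS⟩ := hfac hRN
  refine ⟨fun k i => S k i, fun i j => ?_⟩
  rw [← hG, hS, hmul]
  simp only [hstar]

end InnerProductModule

/-- A unital C⋆-algebra as a Hilbert module over itself, with inner product `a⋆ b`. -/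
instance InnerProductModule.instSelf (A : Type*) [CStarAlgebra A] [PartialOrder A]
    [StarOrderedRing A] : InnerProductModule A A where
  ip a b := star a * b
  ip_add_right _ _ _ := mul_add _ _ _
  ip_smul_right c a b := mul_smul_comm c (star a) b
  ip_op_smul_right a x y := (mul_assoc (star x) y a).symm
  star_ip x y := by simp
  ip_self_nonneg x := star_mul_self_nonneg x
  eq_zero_of_ip_self x h := (CStarRing.star_mul_self_eq_zero_iff x).mp h
  norm_eq x := by rw [CStarRing.norm_star_mul_self, Real.sqrt_mul_self (norm_nonneg x)]

/-! ### Adjointable maps -/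

/-- The space `B^a(E, F)` of adjointable maps, bundled with the (unique) adjoint. Linearity over
`ℂ` and over `A` is automatic, and so is boundedness when `E` and `F` are complete. -/
structure Adjointable (A : Type*) [CStarAlgebra A] [PartialOrder A]
    (E : Type*) [NormedAddCommGroup E] [NormedSpace ℂ E] [Module Aᵐᵒᵖ E] [InnerProductModule A E]
    (F : Type*) [NormedAddCommGroup F] [NormedSpace ℂ F] [Module Aᵐᵒᵖ F]
    [InnerProductModule A F] where
  toFun : E → F
  /-- the adjoint -/
  adj : F → E
  ip_adj : ∀ x y, ip A (toFun x) y = ip A x (adj y)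

namespace Adjointable

open InnerProductModule

variable {A : Type*} [CStarAlgebra A] [PartialOrder A]
variable {E : Type*} [NormedAddCommGroup E] [NormedSpace ℂ E] [Module Aᵐᵒᵖ E]
  [InnerProductModule A E]
variable {F : Type*} [NormedAddCommGroup F] [NormedSpace ℂ F] [Module Aᵐᵒᵖ F]
  [InnerProductModule A F]
variable {K : Type*} [NormedAddCommGroup K] [NormedSpace ℂ K] [Module Aᵐᵒᵖ K]
  [InnerProductModule A K]

instance : FunLike (Adjointable A E F) E F where
  coe := toFun
  coe_injective := by
    rintro ⟨f, f', hf⟩ ⟨g, g', hg⟩ (h : f = g)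
    subst h
    have : f' = g' := by
      funext y
      exact ext_left A fun z => by rw [← hf, ← hg]
    subst this
    rfl

@[ext]
theorem ext {S T : Adjointable A E F} (h : ∀ x, S x = T x) : S = T :=
  DFunLike.ext _ _ h

theorem ip_apply_left (S : Adjointable A E F) (x : E) (y : F) :
    ip A (S x) y = ip A x (S.adj y) :=
  S.ip_adj x y

theorem ip_apply_right (S : Adjointable A E F) (x : E) (y : F) :
    ip A y (S x) = ip A (S.adj y) x := by
  rw [← star_ip, ip_apply_left, star_ip]

theorem map_add (S : Adjointable A E F) (x y : E) : S (x + y) = S x + S y :=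
  ext_left A fun z => by simp only [ip_add_right, ip_apply_right]

theorem map_smul (S : Adjointable A E F) (c : ℂ) (x : E) : S (c • x) = c • S x :=
  ext_left A fun z => by simp only [ip_smul_right, ip_apply_right]

theorem map_zero (S : Adjointable A E F) : S 0 = 0 :=
  ext_left A fun z => by simp only [ip_zero_right, ip_apply_right]

/-- The adjoint `S⋆` of an adjointable map, as an adjointable map. -/
def adjoint (S : Adjointable A E F) : Adjointable A F E where
  toFun := S.adj
  adj := S.toFun
  ip_adj x y := (S.ip_apply_right y x).symm

/-- Composition of adjointable maps. -/
def comp (S : Adjointable A F K) (T : Adjointable A E F) : Adjointable A E K where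
  toFun x := S (T x)
  adj y := T.adj (S.adj y)
  ip_adj x y := by rw [ip_apply_left, ip_apply_left]

@[simp] theorem comp_apply (S : Adjointable A F K) (T : Adjointable A E F) (x : E) :
    S.comp T x = S (T x) := rfl

/-! `B^a(E)` is a complex ⋆-algebra, with composition as product and the adjoint as star. -/

instance : Zero (Adjointable A E E) := ⟨⟨fun _ => 0, fun _ => 0, fun _ _ => by
  rw [ip_zero_left, ip_zero_right]⟩⟩
instance : One (Adjointable A E E) := ⟨⟨id, id, fun _ _ => rfl⟩⟩
instance : Mul (Adjointable A E E) := ⟨fun S T => S.comp T⟩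
instance : Star (Adjointable A E E) := ⟨fun S => S.adjoint⟩
instance : Add (Adjointable A E E) := ⟨fun S T => ⟨fun x => S x + T x, fun y => S.adj y + T.adj y,
  fun x y => by rw [ip_add_left, ip_add_right, ip_apply_left, ip_apply_left]⟩⟩
instance : SMul ℂ (Adjointable A E E) := ⟨fun c S => ⟨fun x => c • S x, fun y => star c • S.adj y,
  fun x y => by rw [ip_smul_left, ip_smul_right, ip_apply_left]⟩⟩
instance : Neg (Adjointable A E E) := ⟨fun S => (-1 : ℂ) • S⟩

@[simp] theorem zero_apply (x : E) : (0 : Adjointable A E E) x = 0 := rfl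
@[simp] theorem one_apply (x : E) : (1 : Adjointable A E E) x = x := rfl
@[simp] theorem mul_apply (S T : Adjointable A E E) (x : E) : (S * T) x = S (T x) := rfl
@[simp] theorem add_apply (S T : Adjointable A E E) (x : E) : (S + T) x = S x + T x := rfl
@[simp] theorem smul_apply (c : ℂ) (S : Adjointable A E E) (x : E) : (c • S) x = c • S x := rfl
@[simp] theorem neg_apply (S : Adjointable A E E) (x : E) : (-S) x = -S x :=
  neg_one_smul ℂ (S x)
@[simp] theorem star_apply (S : Adjointable A E E) (x : E) : star S x = S.adj x := rfl

instance : AddCommGroup (Adjointable A E E) where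
  add_assoc _ _ _ := by ext; simp [add_assoc]
  zero_add _ := by ext; simp
  add_zero _ := by ext; simp
  add_comm _ _ := by ext; simp [add_comm]
  neg_add_cancel _ := by ext; simp
  nsmul := nsmulRec
  zsmul := zsmulRec

instance : Ring (Adjointable A E E) where
  left_distrib _ _ _ := by ext; simp [map_add]
  right_distrib _ _ _ := by ext; simp
  zero_mul _ := by ext; simp
  mul_zero _ := by ext; simp [map_zero]
  mul_assoc _ _ _ := by ext; simp
  one_mul _ := by ext; simp
  mul_one _ := by ext; simp
  neg_add_cancel := neg_add_cancel
  zsmul := zsmulRec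

instance : Module ℂ (Adjointable A E E) where
  one_smul _ := by ext; simp
  mul_smul _ _ _ := by ext; simp [mul_smul]
  smul_zero _ := by ext; simp
  smul_add _ _ _ := by ext; simp
  add_smul _ _ _ := by ext; simp [add_smul]
  zero_smul _ := by ext; simp

instance : Algebra ℂ (Adjointable A E E) :=
  Algebra.ofModule (fun _ _ _ => by ext; simp) (fun _ _ _ => by ext; simp [map_smul])

instance : StarRing (Adjointable A E E) where
  star_involutive _ := rfl
  star_mul _ _ := rfl
  star_add _ _ := rfl

instance : StarModule ℂ (Adjointable A E E) := ⟨fun _ _ => by ext; rfl⟩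

end Adjointable

/-- A coisometry: `S S⋆ = 1`. In particular `S` is onto. -/
def IsCoisometry {A : Type*} [CStarAlgebra A] [PartialOrder A]
    {E : Type*} [NormedAddCommGroup E] [NormedSpace ℂ E] [Module Aᵐᵒᵖ E] [InnerProductModule A E]
    {F : Type*} [NormedAddCommGroup F] [NormedSpace ℂ F] [Module Aᵐᵒᵖ F] [InnerProductModule A F]
    (S : Adjointable A E F) : Prop :=
  S.comp S.adjoint = 1

/-! ### The interior tensor product `E ⊙ H` and von Neumann modules -/

section Interior

variable {H : Type*} [NormedAddCommGroup H] [InnerProductSpace ℂ H] [CompleteSpace H]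
variable (B : VonNeumannAlgebra H)
variable (E : Type*) [NormedAddCommGroup E] [NormedSpace ℂ E] [Module Bᵐᵒᵖ E]
  [InnerProductModule B E]

open InnerProductModule

/-- The algebraic tensor product `E ⊗ H`, a type synonym which will carry the semi-inner product
`⟪x ⊗ h, y ⊗ k⟫ = ⟪h, ⟨x, y⟩ k⟫`. -/
def PreInteriorTensor (_B : VonNeumannAlgebra H) (E : Type*) [NormedAddCommGroup E]
    [NormedSpace ℂ E] : Type _ := E ⊗[ℂ] H

namespace PreInteriorTensor

instance : AddCommGroup (PreInteriorTensor B E) := inferInstanceAs (AddCommGroup (E ⊗[ℂ] H))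
instance : Module ℂ (PreInteriorTensor B E) := inferInstanceAs (Module ℂ (E ⊗[ℂ] H))

/-- The sesquilinear form determined by `⟪x ⊗ h, y ⊗ k⟫ = ⟪h, ⟨x, y⟩ k⟫`. -/
def form : E ⊗[ℂ] H →ₗ⋆[ℂ] E ⊗[ℂ] H →ₗ[ℂ] ℂ :=
  TensorProduct.lift (LinearMap.mk₂'ₛₗ (starRingEnd ℂ) (starRingEnd ℂ)
    (fun x h => TensorProduct.lift (LinearMap.mk₂ ℂ
      (fun y k => inner ℂ h ((ip B x y : H →L[ℂ] H) k))
      (fun y y' k => by simp [ip_add_right])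
      (fun c y k => by simp [ip_smul_right])
      (fun y k k' => by simp)
      (fun c y k => by simp)))
    (fun x x' h => TensorProduct.ext' fun y k => by simp [ip_add_left])
    (fun c x h => TensorProduct.ext' fun y k => by simp [ip_smul_left])
    (fun x h h' => TensorProduct.ext' fun y k => by simp)
    (fun c x h => TensorProduct.ext' fun y k => by simp [mul_comm]))

theorem form_tmul (x y : E) (h k : H) :
    form B E (x ⊗ₜ h) (y ⊗ₜ k) = inner ℂ h ((ip B x y : H →L[ℂ] H) k) := rfl

theorem form_symm (z w : E ⊗[ℂ] H) : starRingEnd ℂ (form B E w z) = form B E z w := by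
  induction z using TensorProduct.induction_on with
  | zero => simp
  | add z z' hz hz' => simp [hz, hz']
  | tmul x h =>
    induction w using TensorProduct.induction_on with
    | zero => simp
    | add w w' hw hw' => simp [hw, hw']
    | tmul y k =>
      rw [form_tmul, form_tmul, inner_conj_symm, ← star_ip (A := B) y x]
      exact (ContinuousLinearMap.adjoint_inner_right (ip B y x : H →L[ℂ] H) h k).symm

theorem form_nonneg (z : E ⊗[ℂ] H) : 0 ≤ RCLike.re (form B E z z) := by
  obtain ⟨s, rfl⟩ := TensorProduct.exists_finset z
  obtain ⟨S, hS⟩ := exists_gram_factor (A := B) (fun i : s => i.1.1)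
  have key : form B E (∑ i ∈ s, i.1 ⊗ₜ[ℂ] i.2) (∑ i ∈ s, i.1 ⊗ₜ[ℂ] i.2) =
      ∑ k, inner ℂ (∑ i : s, (S k i : H →L[ℂ] H) i.1.2) (∑ i : s, (S k i : H →L[ℂ] H) i.1.2) := by
    have h1 : ∀ k, inner ℂ (∑ i : s, (S k i : H →L[ℂ] H) i.1.2)
        (∑ i : s, (S k i : H →L[ℂ] H) i.1.2) =
        ∑ i : s, ∑ j : s, inner ℂ i.1.2 (((star (S k i) * S k j : B) : H →L[ℂ] H) j.1.2) := by
      intro k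
      rw [sum_inner]
      refine Finset.sum_congr rfl fun i _ => ?_
      rw [inner_sum]
      refine Finset.sum_congr rfl fun j _ => ?_
      exact (ContinuousLinearMap.adjoint_inner_right (S k i : H →L[ℂ] H) _ _).symm
    have h2 : form B E (∑ i ∈ s, i.1 ⊗ₜ[ℂ] i.2) (∑ i ∈ s, i.1 ⊗ₜ[ℂ] i.2) =
        ∑ i : s, ∑ j : s, form B E (i.1.1 ⊗ₜ[ℂ] i.1.2) (j.1.1 ⊗ₜ[ℂ] j.1.2) := by
      rw [← Finset.sum_coe_sort s, _root_.map_sum (form B E), LinearMap.sum_apply]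
      exact Finset.sum_congr rfl fun i _ => _root_.map_sum _ _ _
    rw [h2]
    simp only [h1]
    symm
    refine Finset.sum_comm.trans (Finset.sum_congr rfl fun i _ => ?_)
    refine Finset.sum_comm.trans (Finset.sum_congr rfl fun j _ => ?_)
    symm
    rw [form_tmul, hS i j, ← inner_sum]
    congr 1
    rw [AddSubmonoidClass.coe_finsetSum, _root_.sum_apply]
  rw [key, _root_.map_sum]
  exact Finset.sum_nonneg fun k _ => inner_self_nonneg

/-- The semi-inner product on the algebraic tensor product. -/
abbrev core : PreInnerProductSpace.Core ℂ (PreInteriorTensor B E) where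
  inner z w := form B E z w
  conj_inner_symm z w := form_symm B E z w
  re_inner_nonneg z := form_nonneg B E z
  add_left z z' w := LinearMap.map_add₂ (form B E) z z' w
  smul_left z w c := LinearMap.map_smulₛₗ₂ (form B E) c z w

instance : SeminormedAddCommGroup (PreInteriorTensor B E) :=
  InnerProductSpace.Core.toSeminormedAddCommGroup (c := core B E)
instance : InnerProductSpace ℂ (PreInteriorTensor B E) :=
  InnerProductSpace.ofCore (core B E)

variable {E} in
/-- The elementary tensor `x ⊗ h`. -/
def tmul (x : E) (h : H) : PreInteriorTensor B E := x ⊗ₜ[ℂ] h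

theorem inner_def (z w : PreInteriorTensor B E) : inner ℂ z w = form B E z w := rfl

end PreInteriorTensor

/-- The interior tensor product `E ⊙ H`: the Hilbert space obtained from the algebraic tensor
product by dividing out the vectors of length zero and completing. -/
abbrev InteriorTensor : Type _ := UniformSpace.Completion (PreInteriorTensor B E)

variable {E} in
/-- The elementary tensor `x ⊙ h`. -/
def InteriorTensor.tmul (x : E) (h : H) : InteriorTensor B E :=
  (PreInteriorTensor.tmul B x h : UniformSpace.Completion (PreInteriorTensor B E))

variable {E} in
theorem InteriorTensor.inner_tmul (x y : E) (h k : H) :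
    inner ℂ (InteriorTensor.tmul B x h) (InteriorTensor.tmul B y k) =
      inner ℂ h ((ip B x y : H →L[ℂ] H) k) := by
  rw [InteriorTensor.tmul, InteriorTensor.tmul, UniformSpace.Completion.inner_coe]
  rfl

variable {E} in
/-- The operator `L_x : H → E ⊙ H`, `h ↦ x ⊙ h`. -/
def InteriorTensor.L (x : E) : H →L[ℂ] InteriorTensor B E :=
  LinearMap.mkContinuous
    { toFun := InteriorTensor.tmul B x
      map_add' := fun h k => by
        have h1 : PreInteriorTensor.tmul B x (h + k) =
            PreInteriorTensor.tmul B x h + PreInteriorTensor.tmul B x k :=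
          TensorProduct.tmul_add x h k
        rw [InteriorTensor.tmul, h1]
        exact UniformSpace.Completion.coe_add _ _
      map_smul' := fun c h => by
        have h1 : PreInteriorTensor.tmul B x (c • h) = c • PreInteriorTensor.tmul B x h :=
          TensorProduct.tmul_smul c x h
        rw [InteriorTensor.tmul, h1]
        exact (UniformSpace.Completion.toComplₗᵢ (𝕜 := ℂ) (E := PreInteriorTensor B E)).map_smul
          c _ }
    ‖x‖ (fun h => by
      change ‖InteriorTensor.tmul B x h‖ ≤ ‖x‖ * ‖h‖
      have h1 : ‖InteriorTensor.tmul B x h‖ ^ 2 ≤ ‖(ip B x x : H →L[ℂ] H)‖ * ‖h‖ ^ 2 := by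
        rw [← inner_self_eq_norm_sq (𝕜 := ℂ), InteriorTensor.inner_tmul]
        refine (RCLike.re_le_norm _).trans ((norm_inner_le_norm _ _).trans ?_)
        have := (ip B x x : H →L[ℂ] H).le_opNorm h
        nlinarith [norm_nonneg h]
      have h2 : ‖x‖ ^ 2 = ‖(ip B x x : H →L[ℂ] H)‖ := by
        rw [norm_eq (A := B) x, Real.sq_sqrt (norm_nonneg _)]
        rfl
      rw [← h2, ← mul_pow] at h1
      exact le_of_sq_le_sq h1 (by positivity))

variable {E} in
@[simp] theorem InteriorTensor.L_apply (x : E) (h : H) :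
    InteriorTensor.L B x h = InteriorTensor.tmul B x h := rfl

/-- `E` is a von Neumann `B`-module: identified with `{L_x | x ∈ E}`, it is closed in
`B(H, E ⊙ H)` for the strong operator topology. -/
def IsVonNeumannModule : Prop :=
  IsClosed (Set.range fun x : E =>
    ContinuousLinearMap.toPointwiseConvergenceCLM ℂ (RingHom.id ℂ) H (InteriorTensor B E)
      (InteriorTensor.L B x))

end Interior

/-! ### Dynamical systems on C⋆-algebras and on Hilbert modules -/

/-- A `C⋆`-dynamical system `(G, α, A)`: an action of `G` by ⋆-automorphisms such that
`t ↦ α_t(a)` is continuous for all `a`. -/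
structure CStarDynamicalSystem (G A : Type*) [Group G] [TopologicalSpace G] [CStarAlgebra A] where
  action : G →* (A ≃⋆ₐ[ℂ] A)
  continuous_action : ∀ a, Continuous fun t => action t a

section Dynamics

open InnerProductModule

variable {A : Type*} [CStarAlgebra A] [PartialOrder A]
variable {E : Type*} [NormedAddCommGroup E] [NormedSpace ℂ E] [Module Aᵐᵒᵖ E]
  [InnerProductModule A E]

variable (A E) in
/-- `E` is full: the closed linear span of the inner products is all of `A`. -/
def IsFull : Prop :=
  closure (Submodule.span ℂ {a : A | ∃ x y : E, a = ip A x y} : Set A) = Set.univ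

variable (A) in
/-- `Ψ : E → E` is a morphism of Hilbert C⋆-modules: `⟨Ψ x, Ψ y⟩ = ψ ⟨x, y⟩` for some
⋆-homomorphism `ψ : A → A`. -/
def IsModuleMorphism (Ψ : E → E) : Prop :=
  ∃ ψ : A →⋆ₙₐ[ℂ] A, ∀ x y, ip A (Ψ x) (Ψ y) = ψ (ip A x y)

variable (A E) in
/-- The group `Aut(E)` of isomorphisms of Hilbert C⋆-modules from `E` to itself: bijections `Ψ`
such that `Ψ` and `Ψ⁻¹` are morphisms. -/
def moduleAut : Subgroup (Equiv.Perm E) where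
  carrier := {Ψ | IsModuleMorphism A Ψ ∧ IsModuleMorphism A Ψ.symm}
  mul_mem' := by
    rintro Φ Ψ ⟨⟨φ, hφ⟩, ⟨φ', hφ'⟩⟩ ⟨⟨ψ, hψ⟩, ⟨ψ', hψ'⟩⟩
    refine ⟨⟨φ.comp ψ, fun x y => ?_⟩, ⟨ψ'.comp φ', fun x y => ?_⟩⟩
    · change ip A (Φ (Ψ x)) (Φ (Ψ y)) = φ (ψ _)
      rw [hφ, hψ]
    · change ip A (Ψ.symm (Φ.symm x)) (Ψ.symm (Φ.symm y)) = ψ' (φ' _)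
      rw [hψ', hφ']
  one_mem' := ⟨⟨NonUnitalStarAlgHom.id ℂ A, fun _ _ => rfl⟩,
    ⟨NonUnitalStarAlgHom.id ℂ A, fun _ _ => rfl⟩⟩
  inv_mem' := fun ⟨h, h'⟩ => ⟨h', h⟩

variable (A E) in
/-- A dynamical system `(G, η, E)` on the Hilbert `A`-module `E`. -/
structure ModuleDynamicalSystem (G : Type*) [Group G] [TopologicalSpace G] where
  action : G →* moduleAut A E
  continuous_action : ∀ x : E, Continuous fun t => (action t : Equiv.Perm E) x

/-! The induced `C⋆`-dynamical system `(G, α^η, A)`, `α^η_t ⟨x, y⟩ = ⟨η_t x, η_t y⟩`. -/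

theorem norm_ip_le [StarOrderedRing A] (x y : E) : ‖ip A x y‖ ≤ 2 * ‖x‖ * ‖y‖ := by
  obtain ⟨S, hS⟩ := exists_gram_factor (A := A) ![x, y]
  have h : ∀ i k, ‖S k i‖ ≤ ‖(![x, y] : Fin 2 → E) i‖ := by
    intro i k
    have h1 : star (S k i) * S k i ≤ ip A (![x, y] i) (![x, y] i) := by
      rw [hS]
      exact Finset.single_le_sum (f := fun k => star (S k i) * S k i)
        (fun k _ => star_mul_self_nonneg _) (Finset.mem_univ k)
    have h2 := CStarAlgebra.norm_le_norm_of_nonneg_of_le (star_mul_self_nonneg _) h1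
    rw [CStarRing.norm_star_mul_self, ← sq] at h2
    rw [norm_eq (A := A) (E := E)]
    exact Real.le_sqrt_of_sq_le h2
  have h01 := hS 0 1
  simp only [Matrix.cons_val_zero, Matrix.cons_val_one] at h01
  rw [h01, Fin.sum_univ_two]
  have hb : ∀ k, ‖star (S k 0) * S k 1‖ ≤ ‖x‖ * ‖y‖ := fun k => by
    refine (norm_mul_le _ _).trans ?_
    rw [norm_star]
    exact mul_le_mul (h 0 k) (h 1 k) (norm_nonneg _) (norm_nonneg _)
  have := norm_add_le (star (S 0 0) * S 0 1) (star (S 1 0) * S 1 1)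
  linarith [hb 0, hb 1]

theorem continuous_ip [StarOrderedRing A] : Continuous fun p : E × E => ip A p.1 p.2 := by
  let L : E →L⋆[ℂ] E →L[ℂ] A := LinearMap.mkContinuous₂
    (LinearMap.mk₂'ₛₗ (starRingEnd ℂ) (RingHom.id ℂ) (fun x y : E => ip A x y)
      ip_add_left ip_smul_left ip_add_right ip_smul_right) 2 norm_ip_le
  have : Continuous fun p : E × E => L p.1 p.2 := by fun_prop
  exact this

theorem starAlgHom_ext_of_isFull (hE : IsFull A E) (φ ψ : A →⋆ₙₐ[ℂ] A)
    (h : ∀ x y : E, φ (ip A x y) = ψ (ip A x y)) : φ = ψ := by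
  have hφ : Continuous φ :=
    AddMonoidHomClass.continuous_of_bound φ 1 fun a => by
      simpa using NonUnitalStarAlgHom.norm_apply_le φ a
  have hψ : Continuous ψ :=
    AddMonoidHomClass.continuous_of_bound ψ 1 fun a => by
      simpa using NonUnitalStarAlgHom.norm_apply_le ψ a
  have hd : Dense (Submodule.span ℂ {a : A | ∃ x y : E, a = ip A x y} : Set A) :=
    dense_iff_closure_eq.mpr hE
  refine DFunLike.coe_injective (Continuous.ext_on hd hφ hψ fun a ha => ?_)
  refine Submodule.span_induction ?_ ?_ ?_ ?_ ha
  · rintro _ ⟨x, y, rfl⟩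
    exact h x y
  · simp
  · intro a b _ _ ha hb
    simp [ha, hb]
  · intro c a _ ha
    simp [ha]

variable {G : Type*} [Group G] [TopologicalSpace G]

theorem ModuleDynamicalSystem.existsUnique_induced [StarOrderedRing A]
    (η : ModuleDynamicalSystem A E G) (hE : IsFull A E) :
    ∃! α : CStarDynamicalSystem G A, ∀ t (x y : E),
      α.action t (ip A x y) = ip A ((η.action t : Equiv.Perm E) x) ((η.action t : Equiv.Perm E) y) := by
  choose ψ hψ using fun t => (η.action t).2.1
  have h1 : ψ 1 = NonUnitalStarAlgHom.id ℂ A :=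
    starAlgHom_ext_of_isFull hE _ _ fun x y => by
      rw [← hψ, _root_.map_one]; rfl
  have hm : ∀ s t, ψ (s * t) = (ψ s).comp (ψ t) := fun s t =>
    starAlgHom_ext_of_isFull hE _ _ fun x y => by
      rw [← hψ, NonUnitalStarAlgHom.comp_apply, ← hψ, ← hψ, _root_.map_mul]; rfl
  have hl : ∀ t a, ψ t⁻¹ (ψ t a) = a := fun t a => by
    rw [← NonUnitalStarAlgHom.comp_apply, ← hm, inv_mul_cancel, h1]; rfl
  have hr : ∀ t a, ψ t (ψ t⁻¹ a) = a := fun t a => by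
    rw [← NonUnitalStarAlgHom.comp_apply, ← hm, mul_inv_cancel, h1]; rfl
  let e : G → (A ≃⋆ₐ[ℂ] A) := fun t =>
    { toFun := ψ t, invFun := ψ t⁻¹, left_inv := hl t, right_inv := hr t
      map_mul' := _root_.map_mul (ψ t), map_add' := _root_.map_add (ψ t), map_star' := map_star (ψ t)
      map_smul' := _root_.map_smul (ψ t) }
  have hcont : ∀ a, Continuous fun t => ψ t a := by
    have hd : closure (Submodule.span ℂ {a : A | ∃ x y : E, a = ip A x y} : Set A) ⊆
        {a | Continuous fun t => ψ t a} := by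
      have hs : (Submodule.span ℂ {a : A | ∃ x y : E, a = ip A x y} : Set A) ⊆
          {a | Continuous fun t => ψ t a} := by
        intro a ha
        refine Submodule.span_induction (p := fun a _ => Continuous fun t => ψ t a)
          ?_ ?_ ?_ ?_ ha
        · rintro _ ⟨x, y, rfl⟩
          simp only [← hψ]
          exact continuous_ip.comp
            ((η.continuous_action x).prodMk (η.continuous_action y))
        · simpa using continuous_const
        · intro a b _ _ ha hb
          simp only [_root_.map_add]
          exact ha.add hb
        · intro c a _ ha
          simp only [_root_.map_smul]
          exact ha.const_smul c
      intro a ha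
      refine continuous_of_uniform_approx_of_continuous (fun u hu => ?_)
      obtain ⟨ε, hε, hu⟩ := Metric.mem_uniformity_dist.mp hu
      obtain ⟨b, hb, hab⟩ := Metric.mem_closure_iff.mp ha ε hε
      refine ⟨fun t => ψ t b, hs hb, fun t => hu ?_⟩
      rw [dist_eq_norm, ← _root_.map_sub]
      exact (NonUnitalStarAlgHom.norm_apply_le (ψ t) _).trans_lt (by rwa [← dist_eq_norm])
    intro a
    refine hd ?_
    have : closure (Submodule.span ℂ {a : A | ∃ x y : E, a = ip A x y} : Set A) = Set.univ := hE
    rw [this]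
    trivial
  refine ⟨⟨⟨⟨e, ?_⟩, ?_⟩, hcont⟩, ?_, ?_⟩
  · exact StarAlgEquiv.ext fun a => by
      change ψ 1 a = a
      rw [h1]; rfl
  · intro s t
    exact StarAlgEquiv.ext fun a => by
      change ψ (s * t) a = ψ s (ψ t a)
      rw [hm]; rfl
  · exact fun t x y => (hψ t x y).symm
  · rintro ⟨β, hβ⟩ h
    congr 1
    refine MonoidHom.ext fun t => StarAlgEquiv.ext fun a => ?_
    change β t a = ψ t a
    have := starAlgHom_ext_of_isFull hE (β t : A →⋆ₙₐ[ℂ] A) (ψ t) fun x y => by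
      rw [← hψ]; exact h t x y
    exact DFunLike.congr_fun this a

/-- The `C⋆`-dynamical system `(G, α^η, A)` coming from `(G, η, E)`: the unique one with
`α^η_t ⟨x, y⟩ = ⟨η_t x, η_t y⟩`. -/
def ModuleDynamicalSystem.induced [StarOrderedRing A]
    (η : ModuleDynamicalSystem A E G) (hE : IsFull A E) : CStarDynamicalSystem G A :=
  (η.existsUnique_induced hE).choose

theorem ModuleDynamicalSystem.induced_spec [StarOrderedRing A]
    (η : ModuleDynamicalSystem A E G) (hE : IsFull A E) (t : G) (x y : E) :
    (η.induced hE).action t (ip A x y) =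
      ip A ((η.action t : Equiv.Perm E) x) ((η.action t : Equiv.Perm E) y) :=
  (η.existsUnique_induced hE).choose_spec.1 t x y

end Dynamics

/-! ### Completely positive maps, `τ`-maps, representations -/

section Representations

variable {A : Type*} [CStarAlgebra A] [PartialOrder A]
variable {B : Type*} [CStarAlgebra B] [PartialOrder B]

/-- Complete positivity: `∑ᵢⱼ bⱼ⋆ τ(aⱼ⋆ aᵢ) bᵢ ≥ 0` for all finite families. -/
def IsCompletelyPositive (τ : A →ₗ[ℂ] B) : Prop :=
  ∀ (n : ℕ) (a : Fin n → A) (b : Fin n → B),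
    0 ≤ ∑ i, ∑ j, star (b j) * τ (star (a j) * a i) * b i

variable {E : Type*} [NormedAddCommGroup E] [NormedSpace ℂ E] [Module Aᵐᵒᵖ E]
  [InnerProductModule A E]
variable {F : Type*} [NormedAddCommGroup F] [NormedSpace ℂ F] [Module Bᵐᵒᵖ F]
  [InnerProductModule B F]
variable {F' : Type*} [NormedAddCommGroup F'] [NormedSpace ℂ F'] [Module Bᵐᵒᵖ F']
  [InnerProductModule B F']

/-- `T` is a `τ`-map: `⟨T x, T y⟩ = τ ⟨x, y⟩`. -/
def IsTauMap (τ : A →ₗ[ℂ] B) (T : E → F) : Prop :=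
  ∀ x y, ip B (T x) (T y) = τ (ip A x y)

/-- `Ψ` is a quasi-representation of `E` on `F` and `F'` to which `π` is associated:
`⟨Ψ(y) f₁, Ψ(x) f₂⟩ = ⟨π(⟨x, y⟩) f₁, f₂⟩`. -/
def IsQuasiRepresentation (π : A →⋆ₐ[ℂ] Adjointable B F F) (Ψ : E → Adjointable B F F') : Prop :=
  ∀ x y f₁ f₂, ip B (Ψ y f₁) (Ψ x f₂) = ip B (π (ip A x y) f₁) f₂

variable {G : Type*} [Group G] [TopologicalSpace G]

variable (B F G) in
/-- A unitary representation `v : G → U B^a(F)` of `G` on the module `F`: a group homomorphism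
such that `t ↦ v_t f` is continuous for every `f ∈ F`. -/
structure UnitaryRepOn where
  toHom : G →* unitary (Adjointable B F F)
  continuous_apply : ∀ f : F, Continuous fun t => (toHom t : Adjointable B F F) f

/-- The operator `v_t ∈ B^a(F)`. -/
def UnitaryRepOn.op (v : UnitaryRepOn B F G) (t : G) : Adjointable B F F :=
  (v.toHom t : Adjointable B F F)

/-- `(π, v)` is a covariant representation of `(G, α, A)`: `π(α_t(a)) = v_t π(a) v_t⋆`. -/
def IsCovariantRepresentation (α : CStarDynamicalSystem G A) (π : A →⋆ₐ[ℂ] Adjointable B F F)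
    (v : UnitaryRepOn B F G) : Prop :=
  ∀ a t, π (α.action t a) = v.op t * π a * star (v.op t)

/-- `(w, v)`-covariance of `Ψ` with respect to `(G, η, E)`: `Ψ(η_t(x)) = w_t Ψ(x) v_t⋆`. -/
def IsCovariantQuasi (η : ModuleDynamicalSystem A E G) (Ψ : E → Adjointable B F F')
    (v : UnitaryRepOn B F G) (w : UnitaryRepOn B F' G) : Prop :=
  ∀ x t, Ψ ((η.action t : Equiv.Perm E) x) = (w.op t).comp ((Ψ x).comp (star (v.op t)))

end Representations

end

/-!
# Covariant Stinespring-type dilation of a `τ`-map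

The map `τ` has a minimal Stinespring dilation `(π, V)` on a Hilbert space `K`
(`exists_stinespringDilation`): `K` is the reproducing kernel Hilbert space of the operator-valued
kernel `(a, a') ↦ τ(a⋆ a')`, which is positive because matrices over a C⋆-algebra with positive
compressions to columns are positive (`CStarMatrix.exists_factor_of_compress_nonneg`). The module
`F` of the theorem consists of the operators `X : H → K` with `V⋆ π(a) X ∈ B` for all `a ∈ A`, and
`F'` is the von Neumann submodule of `E'` generated by the range of `T`, described as a
biorthogonal complement. All maps between the modules are left multiplications by operators between
the Hilbert spaces `H`, `K` and `E' ⊙ H`, and by minimality these operators are determined by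
prescribing them on the vectors `π(a) V h`:
`v_t π(a) V h = π(α_t a) V u_t h` and `Ψ(x) π(a) V h = T(x a) ⊙ h`.

One density argument (`sot_mem_closure_span`) carries all the von Neumann module theory. If
operators `m i : H → K` satisfy `(m i)⋆ (m j) ∈ B` and `(m i)⋆ Y ∈ B`, then the compression of `Y`
to the closed span of the ranges of the `m i` is a strong limit of combinations of the `(m i) b`
with `b ∈ B`. It gives

* `X⋆ Y ∈ B` for `X, Y ∈ F`, so that `F` is an inner-product module;
* `Ψ(x) F ⊆ F'`, since `E'` is strongly closed in `B(H, E' ⊙ H)`;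
* that `F'` is complemented in `E'`, so that the coisometry `S : E' → F'` exists.

The strong continuity of `u` on `H` does not give norm continuity of `v` on `F`. That comes from
`E'`: `t ↦ Ψ(x) v_t X = w_t Ψ(η_{t⁻¹} x) X` is norm continuous because `w` is a restriction of the
action of `u'` on `E'`, hence so is `t ↦ π⟨y, x⟩ v_t X = Ψ(y)⋆ Ψ(x) v_t X`, and fullness of `E`
makes `π(1) = 1` a norm limit of combinations of the `π⟨y, x⟩`
(`StinespringDilation.continuous_of_continuous_comp`).
-/

noncomputable section

open ModuleInner MulOpposite InnerProductModule
open scoped InnerProduct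

/-! ### Completely positive maps and positive matrices -/

theorem IsCompletelyPositive.map_nonneg {A B : Type*} [CStarAlgebra A] [PartialOrder A]
    [StarOrderedRing A] [CStarAlgebra B] [PartialOrder B] {τ : A →ₗ[ℂ] B}
    (hτ : IsCompletelyPositive τ) {a : A} (ha : 0 ≤ a) : 0 ≤ τ a := by
  obtain ⟨c, rfl⟩ := CStarAlgebra.nonneg_iff_eq_star_mul_self.mp ha
  simpa using hτ 1 (fun _ => c) (fun _ => 1)

theorem IsCompletelyPositive.map_star {A B : Type*} [CStarAlgebra A] [PartialOrder A]
    [StarOrderedRing A] [CStarAlgebra B] [PartialOrder B] [StarOrderedRing B] {τ : A →ₗ[ℂ] B}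
    (hτ : IsCompletelyPositive τ) (a : A) : τ (star a) = star (τ a) :=
  StarHomClass.map_star (PositiveLinearMap.mk₀ τ fun _ => hτ.map_nonneg) a

theorem IsCompletelyPositive.nonneg_of_fintype {A B : Type*} [CStarAlgebra A] [PartialOrder A]
    [CStarAlgebra B] [PartialOrder B] {τ : A →ₗ[ℂ] B}
    (hτ : IsCompletelyPositive τ) {n : Type*} [Fintype n] (a : n → A) (b : n → B) :
    0 ≤ ∑ i, ∑ j, star (b i) * τ (star (a i) * a j) * b j := by
  classical
  let e := Fintype.equivFin n
  have h := hτ (Fintype.card n) (a ∘ e.symm) (b ∘ e.symm)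
  rw [Finset.sum_comm] at h
  refine h.trans_eq ?_
  rw [← e.symm.sum_comp]
  refine Finset.sum_congr rfl fun i _ => ?_
  rw [← e.symm.sum_comp]
  rfl

/-- A self-adjoint matrix over a C⋆-algebra with positive compressions to all columns is a positive
element of the matrix algebra. -/
theorem CStarMatrix.exists_factor_of_compress_nonneg {B : Type*} [CStarAlgebra B] [PartialOrder B]
    [StarOrderedRing B] {n : Type*} [Fintype n] (g : n → n → B)
    (hg : ∀ i j, star (g i j) = g j i)
    (hpos : ∀ b : n → B, 0 ≤ ∑ i, ∑ j, star (b i) * g i j * b j) :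
    ∃ S : n → n → B, ∀ i j, g i j = ∑ k, star (S k i) * S k j := by
  classical
  let G : CStarMatrix n n B := CStarMatrix.ofMatrix (Matrix.of g)
  have hG : ∀ i j, G i j = g i j := fun i j => rfl
  have hsa : IsSelfAdjoint G := by
    ext i j
    rw [CStarMatrix.star_apply, hG, hG, hg]
  obtain ⟨N, R, hN, hkey, hfac⟩ := exists_negPart_factor G hsa
  have hmul : ∀ (X Y : CStarMatrix n n B) (i j : n), (X * Y) i j = ∑ k, X i k * Y k j :=
    fun X Y i j => Matrix.mul_apply
  have hstar : ∀ (X : CStarMatrix n n B) (i j : n), (star X) i j = star (X j i) :=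
    fun X i j => CStarMatrix.star_apply
  -- the diagonal entries of `N G N = -(R N)⋆ (R N)` are compressions to the columns of `N`
  have hRN : R * N = 0 := by
    ext j k
    have h1 : (N * G * N) k k = ∑ i, ∑ j, star (N i k) * g i j * N j k := by
      rw [hmul, Finset.sum_comm]
      refine Finset.sum_congr rfl fun j _ => ?_
      rw [hmul, Finset.sum_mul]
      refine Finset.sum_congr rfl fun i _ => ?_
      rw [hG, ← hstar, hN.star_eq]
    have h2 : (N * G * N) k k = -∑ j, star ((R * N) j k) * (R * N) j k := by
      rw [hkey]
      change -((star (R * N) * (R * N)) k k) = _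
      rw [hmul]
      simp only [hstar]
    have h3 : 0 ≤ -∑ j, star ((R * N) j k) * (R * N) j k := by
      rw [← h2, h1]
      exact hpos _
    have h4 : ∀ j ∈ Finset.univ, 0 ≤ star ((R * N) j k) * (R * N) j k :=
      fun j _ => star_mul_self_nonneg _
    have h5 : ∑ j, star ((R * N) j k) * (R * N) j k = 0 :=
      le_antisymm (neg_nonneg.mp h3) (Finset.sum_nonneg h4)
    have h6 := (Finset.sum_eq_zero_iff_of_nonneg h4).mp h5 j (Finset.mem_univ j)
    exact (CStarRing.star_mul_self_eq_zero_iff _).mp h6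
  obtain ⟨S, hS⟩ := hfac hRN
  refine ⟨fun k i => S k i, fun i j => ?_⟩
  rw [← hG, hS, hmul]
  simp only [hstar]

/-! ### Minimal Stinespring dilations -/

section Dilation

variable {A : Type*} [CStarAlgebra A]
variable {H : Type*} [NormedAddCommGroup H] [InnerProductSpace ℂ H] [CompleteSpace H]
variable {B : VonNeumannAlgebra H}

/-- Complete positivity compresses by elements of `B` only; positivity on arbitrary vectors of `H`
follows from a factorization of the matrix `(τ(aᵢ⋆ aⱼ))` over `B`. -/
theorem posSemidef_kernel_of_isCompletelyPositive [PartialOrder A] [StarOrderedRing A]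
    {τ : A →ₗ[ℂ] B} (hτ : IsCompletelyPositive τ) :
    Matrix.PosSemidef
      (Matrix.of fun a a' : A => ((τ (star a * a') : B) : H →L[ℂ] H)) := by
  classical
  have htfae := RKHS.posSemidef_tfae
    (K := Matrix.of fun a a' : A => ((τ (star a * a') : B) : H →L[ℂ] H))
  have h02 := htfae.out 0 2
  refine h02.mpr ⟨?_, fun f => ?_⟩
  · ext1 a a'
    rw [Matrix.conjTranspose_apply, Matrix.of_apply, Matrix.of_apply]
    change ((star (τ (star a' * a)) : B) : H →L[ℂ] H) = _
    rw [← hτ.map_star, star_mul, star_star]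
  · obtain ⟨S, hS⟩ := CStarMatrix.exists_factor_of_compress_nonneg
      (fun a a' : f.support => τ (star (a : A) * a'))
      (fun i j => by rw [← hτ.map_star, star_mul, star_star])
      (fun b => hτ.nonneg_of_fintype (fun a : f.support => (a : A)) b)
    have key : (f.sum fun x w ↦ f.sum fun x' w' ↦
        inner ℂ (((τ (star x' * x) : B) : H →L[ℂ] H) w) w') =
        ∑ k, inner ℂ (∑ i : f.support, (S k i : H →L[ℂ] H) (f i))
          (∑ i : f.support, (S k i : H →L[ℂ] H) (f i)) := by
      have h1 : ∀ k, inner ℂ (∑ i : f.support, (S k i : H →L[ℂ] H) (f i))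
          (∑ i : f.support, (S k i : H →L[ℂ] H) (f i)) =
          ∑ i : f.support, ∑ j : f.support,
            inner ℂ (((star (S k j) * S k i : B) : H →L[ℂ] H) (f i)) (f j) := by
        intro k
        rw [sum_inner]
        refine Finset.sum_congr rfl fun i _ => ?_
        rw [inner_sum]
        refine Finset.sum_congr rfl fun j _ => ?_
        exact (ContinuousLinearMap.adjoint_inner_left (S k j : H →L[ℂ] H) _ _).symm
      simp only [h1, Finsupp.sum]
      rw [← Finset.sum_coe_sort f.support]
      refine Eq.trans (Finset.sum_congr rfl fun i _ => ?_) Finset.sum_comm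
      rw [← Finset.sum_coe_sort f.support]
      refine Eq.trans (Finset.sum_congr rfl fun j _ => ?_) Finset.sum_comm
      rw [hS j i, ← sum_inner]
      congr 1
      rw [AddSubmonoidClass.coe_finsetSum, _root_.sum_apply]
    change 0 ≤ RCLike.re (f.sum fun x w ↦ f.sum fun x' w' ↦
        inner ℂ (((τ (star x' * x) : B) : H →L[ℂ] H) w) w')
    rw [key, _root_.map_sum]
    exact Finset.sum_nonneg fun k _ => inner_self_nonneg

theorem exists_clm_of_total {ι K₁ K₂ : Type*} [NormedAddCommGroup K₁] [InnerProductSpace ℂ K₁]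
    [NormedAddCommGroup K₂] [InnerProductSpace ℂ K₂] [CompleteSpace K₂]
    {g : ι → K₁} (hg : (Submodule.span ℂ (Set.range g)).topologicalClosure = ⊤) (f : ι → K₂)
    (C : ℝ) (h : ∀ z : ι →₀ ℂ,
      ‖Finsupp.linearCombination ℂ f z‖ ≤ C * ‖Finsupp.linearCombination ℂ g z‖) :
    ∃ W : K₁ →L[ℂ] K₂, ∀ i, W (g i) = f i := by
  have hd : DenseRange (Finsupp.linearCombination ℂ g) := by
    rw [DenseRange, ← LinearMap.coe_range, Finsupp.range_linearCombination]
    exact Submodule.dense_iff_topologicalClosure_eq_top.mpr hg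
  refine ⟨(Finsupp.linearCombination ℂ f).extendOfNorm (Finsupp.linearCombination ℂ g),
    fun i => ?_⟩
  have := LinearMap.extendOfNorm_eq hd ⟨C, h⟩ (Finsupp.single i 1)
  simpa using this

theorem clm_ext_of_total {ι K₁ K₂ : Type*} [NormedAddCommGroup K₁] [InnerProductSpace ℂ K₁]
    [NormedAddCommGroup K₂] [InnerProductSpace ℂ K₂]
    {g : ι → K₁} (hg : (Submodule.span ℂ (Set.range g)).topologicalClosure = ⊤)
    {W W' : K₁ →L[ℂ] K₂} (h : ∀ i, W (g i) = W' (g i)) : W = W' :=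
  ContinuousLinearMap.ext_on (Submodule.dense_iff_topologicalClosure_eq_top.mpr hg)
    (by rintro _ ⟨i, rfl⟩; exact h i)

theorem eq_of_total {ι K : Type*} [NormedAddCommGroup K] [InnerProductSpace ℂ K]
    {g : ι → K} (hg : (Submodule.span ℂ (Set.range g)).topologicalClosure = ⊤)
    {x y : K} (h : ∀ i, inner ℂ (g i) x = inner ℂ (g i) y) : x = y :=
  ext_inner_left ℂ fun z => by
    have := clm_ext_of_total hg (W := (innerSL ℂ x)) (W' := innerSL ℂ y) fun i => by
      rw [innerSL_apply_apply, innerSL_apply_apply, ← inner_conj_symm, h, inner_conj_symm]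
    rw [← inner_conj_symm, ← innerSL_apply_apply ℂ x, this, innerSL_apply_apply, inner_conj_symm]

theorem inner_linearCombination {ι K : Type*} [NormedAddCommGroup K] [InnerProductSpace ℂ K]
    (g : ι → K) (z : ι →₀ ℂ) :
    inner ℂ (Finsupp.linearCombination ℂ g z) (Finsupp.linearCombination ℂ g z) =
      z.sum fun i c => z.sum fun j d => starRingEnd ℂ c * (d * inner ℂ (g i) (g j)) := by
  simp only [Finsupp.linearCombination_apply, Finsupp.sum_inner, Finsupp.inner_sum,
    inner_smul_left, inner_smul_right]
  simp only [Finsupp.sum, Finset.mul_sum]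
  rw [Finset.sum_comm]
  simp only [mul_left_comm]

variable (B) in
/-- A minimal Stinespring dilation of `τ : A → B ⊆ B(H)`: a representation `π` of `A` on `K` and an
operator `V : H → K` such that `τ(a) = V⋆ π(a) V` and the vectors `π(a) V h` are total in `K`. -/
structure StinespringDilation (τ : A →ₗ[ℂ] B) (K : Type*) [NormedAddCommGroup K]
    [InnerProductSpace ℂ K] [CompleteSpace K] where
  π : A →⋆ₐ[ℂ] (K →L[ℂ] K)
  V : H →L[ℂ] K
  adjoint_comp : ∀ a, V† ∘L π a ∘L V = (τ a : H →L[ℂ] H)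
  total : (Submodule.span ℂ (Set.range fun p : A × H => (π p.1) (V p.2))).topologicalClosure = ⊤

open RKHS in
theorem exists_stinespringDilation {A : Type uA} [CStarAlgebra A] [PartialOrder A]
    [StarOrderedRing A] {H : Type uH} [NormedAddCommGroup H] [InnerProductSpace ℂ H]
    [CompleteSpace H] {B : VonNeumannAlgebra H}
    {τ : A →ₗ[ℂ] B} (hτ : IsCompletelyPositive τ) :
    ∃ (K : Type (max uA uH)) (_ : NormedAddCommGroup K) (_ : InnerProductSpace ℂ K)
      (_ : CompleteSpace K),
      Nonempty (StinespringDilation B τ K) := by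
  let k := Matrix.of fun a a' : A => ((τ (star a * a') : B) : H →L[ℂ] H)
  have hk : Fact k.PosSemidef := ⟨posSemidef_kernel_of_isCompletelyPositive hτ⟩
  let g : A × H → OfKernel k := fun p => kerFun (OfKernel k) p.1 p.2
  have hinner : ∀ p q : A × H, inner ℂ (g p) (g q) =
      inner ℂ p.2 (((τ (star p.1 * q.1) : B) : H →L[ℂ] H) q.2) := by
    intro p q
    have h : kernel (OfKernel k) = k := OfKernel.kernel_ofKernel
    rw [kerFun_inner, kerFun_apply, h]
    rfl
  have hg : (Submodule.span ℂ (Set.range g)).topologicalClosure = ⊤ := by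
    rw [← kerFun_dense (OfKernel k)]
    congr 2
    ext z
    simp [g]
  -- the form `Q c z = ⟪z, π(c) z⟫`, additive in `c`
  let Q : A → (A × H →₀ ℂ) → ℂ := fun c z => z.sum fun p a => z.sum fun q b =>
    starRingEnd ℂ a * (b * inner ℂ p.2 (((τ (star p.1 * (c * q.1)) : B) : H →L[ℂ] H) q.2))
  have hQ : ∀ (c : A) z, (‖Finsupp.linearCombination ℂ (fun p => g (c * p.1, p.2)) z‖ ^ 2 : ℂ) =
      Q (star c * c) z := by
    intro c z
    rw [← Complex.coe_algebraMap]
    rw [← inner_self_eq_norm_sq_to_K (𝕜 := ℂ), inner_linearCombination]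
    simp only [hinner, Q, star_mul, mul_assoc]
  have hQadd : ∀ (c d : A) z, Q (c + d) z = Q c z + Q d z := by
    intro c d z
    simp only [Q, Finsupp.sum, ← Finset.sum_add_distrib]
    refine Finset.sum_congr rfl fun p _ => Finset.sum_congr rfl fun q _ => ?_
    simp [add_mul, mul_add]
  have hQsmul : ∀ (r : ℂ) (c : A) z, Q (r • c) z = r * Q c z := by
    intro r c z
    simp only [Q, Finsupp.sum, Finset.mul_sum]
    refine Finset.sum_congr rfl fun p _ => Finset.sum_congr rfl fun q _ => ?_
    simp only [smul_mul_assoc, mul_smul_comm, _root_.map_smul]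
    simp
    ring
  have hQ1 : ∀ z, Q 1 z = (‖Finsupp.linearCombination ℂ g z‖ ^ 2 : ℂ) := by
    intro z
    simpa using (hQ 1 z).symm
  have hW : ∀ c : A, ∃ W : OfKernel k →L[ℂ] OfKernel k, ∀ p, W (g p) = g (c * p.1, p.2) := by
    intro c
    refine exists_clm_of_total hg _ ‖c‖ fun z => ?_
    -- `‖c‖² - c⋆ c = b⋆ b` turns the bound `‖π(c) z‖ ≤ ‖c‖ ‖z‖` into `0 ≤ ‖π(b) z‖²`
    obtain ⟨b, hb⟩ := CStarAlgebra.nonneg_iff_eq_star_mul_self.mp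
      (sub_nonneg.mpr (CStarAlgebra.star_mul_le_algebraMap_norm_sq (a := c)))
    have h1 : ((‖c‖ ^ 2 : ℝ) : ℂ) • (1 : A) = star c * c + star b * b := by
      rw [← hb, add_sub_cancel, Algebra.algebraMap_eq_smul_one, Complex.coe_smul]
    have h2 := congrArg (Q · z) h1
    simp only [hQsmul, hQadd, ← hQ, hQ1] at h2
    norm_cast at h2
    have h3 : ‖Finsupp.linearCombination ℂ (fun p => g (c * p.1, p.2)) z‖ ^ 2 ≤
        (‖c‖ * ‖Finsupp.linearCombination ℂ g z‖) ^ 2 := by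
      rw [mul_pow, h2]
      exact le_add_of_nonneg_right (sq_nonneg _)
    exact le_of_sq_le_sq h3 (by positivity)
  choose W hW using hW
  have hext {W W' : OfKernel k →L[ℂ] OfKernel k} : (∀ p, W (g p) = W' (g p)) → W = W' :=
    clm_ext_of_total hg
  have hgadd : ∀ (a a' : A) (h : H), g (a + a', h) = g (a, h) + g (a', h) := by
    intro a a' h
    refine eq_of_total hg fun p => ?_
    simp [hinner, mul_add]
  have hgsmul : ∀ (c : ℂ) (a : A) (h : H), g (c • a, h) = c • g (a, h) := by
    intro c a h
    refine eq_of_total hg fun p => ?_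
    simp [hinner]
  let π : A →⋆ₐ[ℂ] (OfKernel k →L[ℂ] OfKernel k) :=
    { toFun := W
      map_one' := hext fun p => by simp [hW]
      map_mul' := fun a b => hext fun p => by simp [hW, mul_assoc]
      map_zero' := hext fun p => by
        have := hgadd 0 0 p.2
        simp_all
      map_add' := fun a b => hext fun p => by simp [hW, add_mul, hgadd]
      commutes' := fun c => hext fun p => by
        simp [hW, Algebra.algebraMap_eq_smul_one, hgsmul]
      map_star' := fun a => hext fun p => by
        refine eq_of_total hg fun q => ?_
        rw [ContinuousLinearMap.star_eq_adjoint, ContinuousLinearMap.adjoint_inner_right]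
        simp [hW, hinner, mul_assoc] }
  have hπ : ∀ a p, π a (g p) = g (a * p.1, p.2) := hW
  refine ⟨OfKernel k, inferInstance, inferInstance, inferInstance,
    ⟨π, kerFun (OfKernel k) 1, fun a => ?_, ?_⟩⟩
  · ext h
    refine ext_inner_left ℂ fun h' => ?_
    rw [ContinuousLinearMap.comp_apply, ContinuousLinearMap.adjoint_inner_right]
    change inner ℂ (g (1, h')) (π a (g (1, h))) = _
    simp [hπ, hinner]
  · have h : (fun p : A × H => π p.1 (kerFun (OfKernel k) 1 p.2)) = g := funext fun p => by
      change π p.1 (g (1, p.2)) = _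
      rw [hπ, mul_one]
    rw [h]
    exact hg

namespace StinespringDilation

variable {τ : A →ₗ[ℂ] B} {K : Type*} [NormedAddCommGroup K] [InnerProductSpace ℂ K]
  [CompleteSpace K] (D : StinespringDilation B τ K)
variable {K₂ : Type*} [NormedAddCommGroup K₂] [InnerProductSpace ℂ K₂]

theorem clm_ext {W W' : K →L[ℂ] K₂} (h : ∀ a, W ∘L D.π a ∘L D.V = W' ∘L D.π a ∘L D.V) : W = W' :=
  clm_ext_of_total D.total fun p => congrArg (fun X : H →L[ℂ] K₂ => X p.2) (h p.1)

theorem inner_total (p q : A × H) : inner ℂ (D.π p.1 (D.V p.2)) (D.π q.1 (D.V q.2)) =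
    inner ℂ p.2 ((τ (star p.1 * q.1) : H →L[ℂ] H) q.2) := by
  rw [← D.adjoint_comp, ContinuousLinearMap.comp_apply, ContinuousLinearMap.adjoint_inner_right,
    _root_.map_mul, StarHomClass.map_star, ContinuousLinearMap.star_eq_adjoint,
    ContinuousLinearMap.comp_apply, mul_apply_eq_comp,
    ContinuousLinearMap.adjoint_inner_right]

/-- The universal property of the minimal dilation: a family `f a : H → K₂` with the inner products
of the vectors `π(d a) V h` defines an operator `π(a) V h ↦ f a h`. -/
theorem exists_clm [CompleteSpace K₂] (f : A → H →L[ℂ] K₂) (d : A)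
    (hf : ∀ a a', (f a)† ∘L f a' = (τ (star a * (star d * d) * a') : H →L[ℂ] H)) :
    ∃ W : K →L[ℂ] K₂, ∀ a, W ∘L D.π a ∘L D.V = f a := by
  suffices h : ∀ z, _ by
    obtain ⟨W, hW⟩ := exists_clm_of_total D.total (fun p => f p.1 p.2) ‖D.π d‖ h
    exact ⟨W, fun a => ContinuousLinearMap.ext fun h => hW (a, h)⟩
  · intro z
    refine le_trans (le_of_eq ?_) ((D.π d).le_opNorm _)
    rw [← sq_eq_sq₀ (norm_nonneg _) (norm_nonneg _), ← Complex.ofReal_inj]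
    have h1 : D.π d (Finsupp.linearCombination ℂ (fun p : A × H => D.π p.1 (D.V p.2)) z) =
        Finsupp.linearCombination ℂ (fun p : A × H => D.π (d * p.1) (D.V p.2)) z := by
      simp [Finsupp.linearCombination_apply, map_finsuppSum]
    have h2 : ∀ x : K, ((‖x‖ ^ 2 : ℝ) : ℂ) = inner ℂ x x := fun x => by
      rw [inner_self_eq_norm_sq_to_K]; simp
    have h3 : ∀ x : K₂, ((‖x‖ ^ 2 : ℝ) : ℂ) = inner ℂ x x := fun x => by
      rw [inner_self_eq_norm_sq_to_K]; simp
    rw [h1, h2, h3, inner_linearCombination, inner_linearCombination]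
    refine Finset.sum_congr rfl fun p _ => Finset.sum_congr rfl fun q _ => ?_
    dsimp only
    rw [D.inner_total (d * p.1, p.2) (d * q.1, q.2), ← ContinuousLinearMap.adjoint_inner_right,
      ← ContinuousLinearMap.comp_apply, hf]
    simp only [star_mul, mul_assoc]

end StinespringDilation

end Dilation

/-! ### Strong closures -/

section StrongClosure

variable {H K : Type*} [NormedAddCommGroup H] [InnerProductSpace ℂ H]
  [NormedAddCommGroup K] [InnerProductSpace ℂ K]

/-- An operator, as a point of `B(H, K)` with the strong operator topology. -/
abbrev sot (X : H →L[ℂ] K) : H →Lₚₜ[ℂ] K :=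
  ContinuousLinearMap.toPointwiseConvergenceCLM ℂ (RingHom.id ℂ) H K X

/-- Approximation on finitely many vectors is membership in the strong closure. -/
theorem sot_mem_closure {S : Set (H →L[ℂ] K)} {X : H →L[ℂ] K}
    (h : ∀ (s : Finset H) (ε : ℝ), 0 < ε → ∃ Y ∈ S, ∀ x ∈ s, ‖Y x - X x‖ < ε) :
    sot X ∈ closure (sot '' S) := by
  have hb := (PointwiseConvergenceCLM.withSeminorms (𝕜₁ := ℂ) (𝕜₂ := ℂ) (σ := RingHom.id ℂ)
    (E := H) (F := K)).hasBasis_ball (x := sot X)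
  rw [mem_closure_iff_nhds_basis hb]
  rintro ⟨s, ε⟩ hε
  obtain ⟨Y, hY, hs⟩ := h s ε hε
  refine ⟨sot Y, ⟨Y, hY, rfl⟩, ?_⟩
  rw [Seminorm.mem_ball]
  exact Seminorm.finset_sup_apply_lt hε fun x hx => hs x hx

variable [CompleteSpace H]

theorem VonNeumannAlgebra.mem_iff_commute (B : VonNeumannAlgebra H) {X : H →L[ℂ] H} :
    X ∈ B ↔ ∀ c ∈ B.commutant, ∀ h, c (X h) = X (c h) := by
  conv_lhs => rw [← B.commutant_commutant, VonNeumannAlgebra.mem_commutant_iff]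
  exact forall₂_congr fun c _ => ContinuousLinearMap.ext_iff

theorem VonNeumannAlgebra.isClosed_sot (B : VonNeumannAlgebra H) :
    IsClosed (sot '' (B : Set (H →L[ℂ] H))) := by
  have h : sot '' (B : Set (H →L[ℂ] H)) =
      ⋂ c ∈ B.commutant, ⋂ h : H, {X : H →Lₚₜ[ℂ] H | c (X h) = X (c h)} := by
    ext X
    simp only [Set.mem_iInter]
    constructor
    · rintro ⟨Y, hY, rfl⟩
      exact B.mem_iff_commute.mp hY
    · exact fun h => ⟨X, B.mem_iff_commute.mpr h, rfl⟩
  rw [h]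
  refine isClosed_biInter fun c _ => isClosed_iInter fun x => isClosed_eq ?_ ?_
  · exact c.continuous.comp (continuous_eval_const x)
  · exact continuous_eval_const (c x)

variable [CompleteSpace K]

/-- Let `m i : H → K` be operators with `(m i)⋆ (m j) ∈ B`. If `(m i)⋆ Y ∈ B` for all `i`, then the
compression of `Y` to the closed span of the ranges of the `m i` is a strong limit of linear
combinations of the operators `(m i) b` with `b ∈ B`. The compression enters through an operator `P`
with range in the closed span and `(m i)⋆ P = (m i)⋆ Y`. -/
theorem sot_mem_closure_span (B : VonNeumannAlgebra H) {ι : Type*} (m : ι → H →L[ℂ] K)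
    (hm : ∀ i j, (m i)† ∘L m j ∈ B) {Y P : H →L[ℂ] K} (hY : ∀ i, (m i)† ∘L Y ∈ B)
    (hP : ∀ i, (m i)† ∘L P = (m i)† ∘L Y)
    (hP' : ∀ z : K, (∀ i, ((m i)†) z = 0) → ∀ h, inner ℂ z (P h) = 0) :
    sot P ∈ closure (sot '' (Submodule.span ℂ {X | ∃ i, ∃ b ∈ B, X = m i ∘L b} :
      Set (H →L[ℂ] K))) := by
  refine sot_mem_closure fun s ε hε => ?_
  set M := Submodule.span ℂ {X | ∃ i, ∃ b ∈ B, X = m i ∘L b} with hM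
  have hmM : ∀ i, ∀ X ∈ M, m i ∘L (m i)† ∘L X ∈ M := by
    intro i X hX
    induction hX using Submodule.span_induction with
    | mem X hX =>
      obtain ⟨j, b, hb, rfl⟩ := hX
      exact Submodule.subset_span ⟨i, ((m i)† ∘L m j) * b, mul_mem (hm i j) hb, rfl⟩
    | zero => simp
    | add X X' _ _ hX hX' => simpa using M.add_mem hX hX'
    | smul c X _ hX => simpa using M.smul_mem c hX
  -- evaluation on the finitely many vectors of `s`, as a map into the direct sum `K ^ s`
  let ev : (H →L[ℂ] K) →ₗ[ℂ] PiLp 2 (fun _ : s => K) :=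
    { toFun := fun X => WithLp.toLp 2 fun h => X h
      map_add' := fun _ _ => rfl
      map_smul' := fun _ _ => rfl }
  let U := M.map ev
  -- the amplification of `(m i) (m i)⋆`
  let d : ι → PiLp 2 (fun _ : s => K) → PiLp 2 (fun _ : s => K) :=
    fun i x => WithLp.toLp 2 fun h => m i (((m i)†) (x h))
  have hd : ∀ i x y, inner ℂ (d i x) y = inner ℂ x (d i y) := by
    intro i x y
    simp only [PiLp.inner_apply, d]
    refine Finset.sum_congr rfl fun h _ => ?_
    rw [← ContinuousLinearMap.adjoint_inner_right, ContinuousLinearMap.adjoint_inner_left]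
  have hdsub : ∀ i x y, d i (x - y) = d i x - d i y := by
    intro i x y
    ext h
    simp [d]
  have hdU : ∀ i, ∀ x ∈ U, d i x ∈ U := by
    rintro i _ ⟨X, hX, rfl⟩
    exact ⟨_, hmM i X hX, rfl⟩
  have hdU' : ∀ i, ∀ x ∈ Uᗮ, d i x ∈ Uᗮ := by
    intro i x hx y hy
    rw [← hd]
    exact hx _ (hdU i y hy)
  have hdU'' : ∀ i, ∀ x ∈ Uᗮᗮ, d i x ∈ Uᗮᗮ := by
    intro i x hx y hy
    rw [← hd]
    exact hx _ (hdU' i y hy)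
  have : CompleteSpace (PiLp 2 (fun _ : s => K)) := inferInstance
  have : CompleteSpace ↥(Submodule.orthogonal U) :=
    (Submodule.isClosed_orthogonal U).completeSpace_coe
  have : (Submodule.orthogonal U).HasOrthogonalProjection :=
    Submodule.HasOrthogonalProjection.ofCompleteSpace _
  -- the component `z` of `ev P` orthogonal to `U` vanishes: `d i z` lies in `Uᗮ`, and also in `Uᗮᗮ`
  -- because `d i (ev P) = d i (ev Y)` lies in `U`
  obtain ⟨z, hz, y, hy, hzy⟩ := (Submodule.orthogonal U).exists_add_mem_mem_orthogonal (ev P)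
  have hdz : ∀ i, d i z = 0 := by
    intro i
    have h1 : z = ev P - y := eq_sub_of_add_eq hzy.symm
    have h2 : d i (ev P) ∈ U := by
      refine ⟨m i ∘L (m i)† ∘L Y, Submodule.subset_span ⟨i, _, hY i, rfl⟩, ?_⟩
      rw [← hP]
      rfl
    have h3 : d i z ∈ Uᗮᗮ := by
      rw [h1, hdsub]
      exact sub_mem (U.le_orthogonal_orthogonal h2) (hdU'' i y hy)
    exact inner_self_eq_zero.mp (h3 _ (hdU' i z hz))
  have hmz : ∀ i (h : s), ((m i)†) (z h) = 0 := by
    intro i h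
    have h1 : m i (((m i)†) (z h)) = 0 := congrArg (fun x : PiLp 2 (fun _ : s => K) => x h) (hdz i)
    rw [← inner_self_eq_zero (𝕜 := ℂ), ContinuousLinearMap.adjoint_inner_left, h1,
      inner_zero_right]
  have hz0 : z = 0 := by
    have h1 : inner ℂ z (ev P) = 0 := by
      rw [PiLp.inner_apply]
      exact Finset.sum_eq_zero fun h _ => hP' (z h) (fun i => hmz i h) h
    rw [hzy, inner_add_right, hy z hz, add_zero] at h1
    exact inner_self_eq_zero.mp h1
  rw [hz0, zero_add] at hzy
  rw [← hzy, Submodule.orthogonal_orthogonal_eq_closure] at hy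
  obtain ⟨_, ⟨X, hX, rfl⟩, hXε⟩ := Metric.mem_closure_iff.mp hy ε hε
  refine ⟨X, hX, fun x hx => ?_⟩
  rw [dist_comm, dist_eq_norm] at hXε
  exact (PiLp.norm_apply_le (ev X - ev P) (⟨x, hx⟩ : s)).trans_lt hXε

end StrongClosure

/-! ### Von Neumann modules inside spaces of operators -/

section VonNeumannModule

variable {H : Type*} [NormedAddCommGroup H] [InnerProductSpace ℂ H] [CompleteSpace H]
variable (B : VonNeumannAlgebra H)
variable {E : Type*} [NormedAddCommGroup E] [NormedSpace ℂ E] [Module Bᵐᵒᵖ E]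
  [InnerProductModule B E]

namespace InteriorTensor

variable (E) in
theorem total : (Submodule.span ℂ
    (Set.range fun p : E × H => tmul B p.1 p.2)).topologicalClosure = ⊤ := by
  rw [← Submodule.dense_iff_topologicalClosure_eq_top]
  have hd := UniformSpace.Completion.denseRange_coe (α := PreInteriorTensor B E)
  refine hd.mono ?_
  rintro _ ⟨z, rfl⟩
  induction z using TensorProduct.induction_on with
  | zero =>
    have : ((0 : PreInteriorTensor B E) : UniformSpace.Completion (PreInteriorTensor B E)) = 0 :=
      UniformSpace.Completion.coe_zero
    exact this ▸ Submodule.zero_mem _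
  | tmul x h => exact Submodule.subset_span ⟨(x, h), rfl⟩
  | add x y hx hy =>
    have : (((show PreInteriorTensor B E from x) + (show PreInteriorTensor B E from y) :
        PreInteriorTensor B E) : UniformSpace.Completion (PreInteriorTensor B E)) =
        ((show PreInteriorTensor B E from x) : UniformSpace.Completion (PreInteriorTensor B E)) +
        ((show PreInteriorTensor B E from y) : UniformSpace.Completion (PreInteriorTensor B E)) :=
      UniformSpace.Completion.coe_add _ _
    exact this ▸ Submodule.add_mem _ hx hy

theorem adjoint_L_comp_L (x y : E) : (L B x)† ∘L L B y = (ip B x y : H →L[ℂ] H) := by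
  ext h
  refine ext_inner_left ℂ fun k => ?_
  rw [ContinuousLinearMap.comp_apply, ContinuousLinearMap.adjoint_inner_right, L_apply, L_apply,
    inner_tmul]

theorem L_injective : Function.Injective (L B : E → _) := fun x y h =>
  ext_left B fun z => Subtype.ext <| by rw [← adjoint_L_comp_L, h, adjoint_L_comp_L]

theorem ext_of_adjoint_L {X Y : H →L[ℂ] InteriorTensor B E}
    (h : ∀ x : E, (L B x)† ∘L X = (L B x)† ∘L Y) : X = Y := by
  ext k
  refine eq_of_total (total B E) fun p => ?_
  change inner ℂ (L B p.1 p.2) (X k) = inner ℂ (L B p.1 p.2) (Y k)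
  rw [← ContinuousLinearMap.adjoint_inner_right, ← ContinuousLinearMap.adjoint_inner_right]
  exact congrArg (fun Z : H →L[ℂ] H => inner ℂ p.2 (Z k)) (h p.1)

theorem L_op_smul (b : B) (x : E) : L B (op b • x) = L B x ∘L (b : H →L[ℂ] H) :=
  ext_of_adjoint_L B fun z => by
    rw [adjoint_L_comp_L, ip_op_smul_right, ← ContinuousLinearMap.comp_assoc, adjoint_L_comp_L]
    rfl

variable (E) in
/-- `x ↦ L_x` as a linear map. -/
def Lₗ : E →ₗ[ℂ] H →L[ℂ] InteriorTensor B E where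
  toFun := L B
  map_add' x y := ext_of_adjoint_L B fun z => by
    rw [adjoint_L_comp_L, ip_add_right, ContinuousLinearMap.comp_add, adjoint_L_comp_L,
      adjoint_L_comp_L]
    rfl
  map_smul' c x := ext_of_adjoint_L B fun z => by
    rw [adjoint_L_comp_L, ip_smul_right, RingHom.id_apply, ContinuousLinearMap.comp_smul,
      adjoint_L_comp_L]
    rfl

@[simp] theorem Lₗ_apply (x : E) : Lₗ B E x = L B x := rfl

end InteriorTensor

open InteriorTensor

/-- An inner-product module faithfully represented by operators `H → K` is a von Neumann module as
soon as its image is strongly closed: `E ⊙ H` embeds isometrically into `K`. -/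
theorem isVonNeumannModule_of_isClosed {K : Type*} [NormedAddCommGroup K] [InnerProductSpace ℂ K]
    [CompleteSpace K] (ι : E → H →L[ℂ] K) (hι : ∀ x y, (ι x)† ∘L ι y = (ip B x y : H →L[ℂ] H))
    (hcl : IsClosed (sot '' Set.range ι)) : IsVonNeumannModule B E := by
  have hι' : ∀ x y h k, inner ℂ (ι x h) (ι y k) = inner ℂ (tmul B x h) (tmul B y k) := by
    intro x y h k
    rw [inner_tmul, ← hι, ContinuousLinearMap.comp_apply, ContinuousLinearMap.adjoint_inner_right]
  obtain ⟨J, hJ⟩ := exists_clm_of_total (total B E) (fun p => ι p.1 p.2) 1 fun z => by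
    rw [one_mul, ← sq_le_sq₀ (norm_nonneg _) (norm_nonneg _), ← inner_self_eq_norm_sq (𝕜 := ℂ),
      ← inner_self_eq_norm_sq (𝕜 := ℂ), inner_linearCombination, inner_linearCombination]
    simp only [hι', le_refl]
  have hJL : ∀ x, J ∘L L B x = ι x := fun x => ContinuousLinearMap.ext fun h => hJ (x, h)
  have hJJ : J† ∘L J = ContinuousLinearMap.id ℂ _ := clm_ext_of_total (total B E) fun p =>
    eq_of_total (total B E) fun q => by
      rw [ContinuousLinearMap.comp_apply, ContinuousLinearMap.adjoint_inner_right, hJ, hJ, hι']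
      rfl
  have hinj : ∀ X Y : H →L[ℂ] InteriorTensor B E, J ∘L X = J ∘L Y → X = Y := by
    intro X Y h
    rw [← ContinuousLinearMap.id_comp X, ← hJJ, ContinuousLinearMap.comp_assoc, h,
      ← ContinuousLinearMap.comp_assoc, hJJ, ContinuousLinearMap.id_comp]
  have : (Set.range fun x : E => sot (L B x)) =
      PointwiseConvergenceCLM.postcomp H J ⁻¹' (sot '' Set.range ι) := by
    ext X
    constructor
    · rintro ⟨x, rfl⟩
      exact ⟨ι x, ⟨x, rfl⟩, (hJL x).symm⟩
    · rintro ⟨_, ⟨x, rfl⟩, hx⟩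
      refine ⟨x, ?_⟩
      have hx' : ι x = J ∘L (show H →L[ℂ] InteriorTensor B E from X) := hx
      exact hinj _ X ((hJL x).trans hx')
  change IsClosed (Set.range fun x : E => sot (L B x))
  rw [this]
  exact hcl.preimage (PointwiseConvergenceCLM.postcomp H J).continuous

end VonNeumannModule

/-! ### Biorthogonal complements in von Neumann modules -/

section Perp

variable {H : Type*} [NormedAddCommGroup H] [InnerProductSpace ℂ H] [CompleteSpace H]
variable (B : VonNeumannAlgebra H)
variable {E : Type*} [NormedAddCommGroup E] [NormedSpace ℂ E] [Module Bᵐᵒᵖ E]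
  [InnerProductModule B E]

/-- The orthogonal complement of a subset of an inner-product module. -/
def modulePerp (Z : Set E) : Submodule ℂ E where
  carrier := {y | ∀ z ∈ Z, ip B z y = 0}
  zero_mem' z _ := ip_zero_right z
  add_mem' hx hy z hz := by rw [ip_add_right, hx z hz, hy z hz, add_zero]
  smul_mem' c x hx z hz := by rw [ip_smul_right, hx z hz, smul_zero]

theorem op_smul_mem_modulePerp {Z : Set E} {y : E} (hy : y ∈ modulePerp B Z) (b : Bᵐᵒᵖ) :
    b • y ∈ modulePerp B Z := fun z hz => by
  rw [← op_unop b, ip_op_smul_right, hy z hz, zero_mul]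

instance (Z : Set E) : Module Bᵐᵒᵖ (modulePerp B Z) where
  smul b y := ⟨b • (y : E), op_smul_mem_modulePerp B y.2 b⟩
  one_smul _ := Subtype.ext (one_smul _ _)
  mul_smul _ _ _ := Subtype.ext (mul_smul _ _ _)
  smul_zero _ := Subtype.ext (smul_zero _)
  smul_add _ _ _ := Subtype.ext (smul_add _ _ _)
  add_smul _ _ _ := Subtype.ext (add_smul _ _ _)
  zero_smul _ := Subtype.ext (zero_smul _ _)

instance (Z : Set E) : InnerProductModule B (modulePerp B Z) where
  ip x y := ip B (x : E) (y : E)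
  ip_add_right x y z := ip_add_right (x : E) y z
  ip_smul_right c x y := ip_smul_right c (x : E) y
  ip_op_smul_right a x y := ip_op_smul_right a (x : E) y
  star_ip x y := star_ip (x : E) y
  ip_self_nonneg x := ip_self_nonneg (x : E)
  eq_zero_of_ip_self x h := Subtype.ext (eq_zero_of_ip_self (A := B) (x : E) h)
  norm_eq x := norm_eq (x : E)

theorem ip_modulePerp {Z : Set E} (x y : modulePerp B Z) : ip B x y = ip B (x : E) (y : E) := rfl

open InteriorTensor

variable {B}

theorem IsVonNeumannModule.isClosed_sot (hE : IsVonNeumannModule B E) :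
    IsClosed (sot '' ((LinearMap.range (Lₗ B E) : Submodule ℂ _) :
      Set (H →L[ℂ] InteriorTensor B E))) := by
  have h : sot '' ((LinearMap.range (Lₗ B E) : Submodule ℂ _) :
      Set (H →L[ℂ] InteriorTensor B E)) = Set.range fun x : E => sot (L B x) := by
    rw [LinearMap.coe_range, ← Set.range_comp]
    rfl
  rw [h]
  exact hE

theorem isVonNeumannModule_modulePerp (hE : IsVonNeumannModule B E) (Z : Set E) :
    IsVonNeumannModule B (modulePerp B Z) := by
  refine isVonNeumannModule_of_isClosed B (fun y : modulePerp B Z => L B (y : E))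
    (fun x y => adjoint_L_comp_L B (x : E) y) ?_
  have h : (sot '' Set.range fun y : modulePerp B Z => L B (y : E)) =
      (Set.range fun x : E => sot (L B x)) ∩
      ⋂ z ∈ Z, PointwiseConvergenceCLM.postcomp H ((L B z)†) ⁻¹' {0} := by
    have h0 : ∀ z x : E, PointwiseConvergenceCLM.postcomp H ((L B z)†) (sot (L B x)) = 0 ↔
        ip B z x = 0 := by
      intro z x
      rw [← ZeroMemClass.coe_eq_zero, ← adjoint_L_comp_L]
      rfl
    ext X
    constructor
    · rintro ⟨_, ⟨y, rfl⟩, rfl⟩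
      refine ⟨⟨y, rfl⟩, Set.mem_iInter₂.mpr fun z hz => ?_⟩
      exact (h0 z y).mpr (y.2 z hz)
    · rintro ⟨⟨x, rfl⟩, hx⟩
      refine ⟨_, ⟨⟨x, fun z hz => ?_⟩, rfl⟩, rfl⟩
      exact (h0 z x).mp (Set.mem_iInter₂.mp hx z hz)
  rw [h]
  refine IsClosed.inter hE (isClosed_biInter fun z _ => ?_)
  exact isClosed_singleton.preimage (PointwiseConvergenceCLM.postcomp H ((L B z)†)).continuous

/-- In a von Neumann module every biorthogonal complement is complemented: the projection onto the
closed span of `Z ⊙ H` in `E ⊙ H` maps `E` to strong limits of elements of `span Z B`. -/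
theorem IsVonNeumannModule.exists_sub_mem_modulePerp (hE : IsVonNeumannModule B E) (Z : Set E)
    (y : E) : ∃ p ∈ modulePerp B (modulePerp B Z : Set E), y - p ∈ modulePerp B Z := by
  let U := (Submodule.span ℂ {k | ∃ z ∈ Z, ∃ h, k = L B z h}).topologicalClosure
  have : CompleteSpace U := Submodule.topologicalClosure.completeSpace _
  have hLU : ∀ z ∈ Z, ∀ h, L B z h ∈ U := fun z hz h =>
    Submodule.le_topologicalClosure _ (Submodule.subset_span ⟨z, hz, h, rfl⟩)
  have hUperp : ∀ k, (∀ z ∈ Z, ((L B z)†) k = 0) → k ∈ Uᗮ := by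
    intro k hk
    rw [Submodule.orthogonal_closure, Submodule.mem_orthogonal]
    intro x hx
    induction hx using Submodule.span_induction with
    | mem x hx =>
      obtain ⟨z, hz, h, rfl⟩ := hx
      rw [← ContinuousLinearMap.adjoint_inner_right, hk z hz, inner_zero_right]
    | zero => exact inner_zero_left _
    | add x x' _ _ hx hx' => rw [inner_add_left, hx, hx', add_zero]
    | smul c x _ hx => rw [inner_smul_left, hx, mul_zero]
  let P := U.starProjection ∘L L B y
  have hP : ∀ z ∈ Z, (L B z)† ∘L P = (L B z)† ∘L L B y := by
    intro z hz
    ext h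
    refine ext_inner_left ℂ fun k => ?_
    simp only [ContinuousLinearMap.comp_apply, ContinuousLinearMap.adjoint_inner_right, P]
    rw [← U.inner_starProjection_left_eq_right,
      Submodule.starProjection_eq_self_iff.mpr (hLU z hz k)]
  have hmem : sot P ∈ sot '' ((LinearMap.range (Lₗ B E) : Submodule ℂ _) :
      Set (H →L[ℂ] InteriorTensor B E)) := by
    rw [← hE.isClosed_sot.closure_eq]
    refine closure_mono (Set.image_mono ?_) (sot_mem_closure_span B (fun z : Z => L B (z : E))
      (fun i j => ?_) (Y := L B y) (fun i => ?_) (fun i => hP i i.2) fun k hk h => ?_)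
    · refine Submodule.span_le.mpr ?_
      rintro _ ⟨z, b, hb, rfl⟩
      exact ⟨op (⟨b, hb⟩ : B) • (z : E), L_op_smul B _ _⟩
    · rw [adjoint_L_comp_L]
      exact Subtype.property _
    · rw [adjoint_L_comp_L]
      exact Subtype.property _
    · exact Submodule.inner_left_of_mem_orthogonal (Submodule.starProjection_apply_mem U _)
        (hUperp k fun z hz => hk ⟨z, hz⟩)
  obtain ⟨_, ⟨p, rfl⟩, hp⟩ := hmem
  have hp' : L B p = P := hp
  refine ⟨p, fun z hz => Subtype.ext ?_, fun z hz => ?_⟩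
  · rw [← adjoint_L_comp_L, hp']
    ext h
    refine ext_inner_left ℂ fun k => ?_
    have hk : L B z k ∈ Uᗮ := hUperp _ fun w hw => by
      rw [← ContinuousLinearMap.comp_apply, adjoint_L_comp_L, hz w hw]
      rfl
    rw [ContinuousLinearMap.comp_apply, ContinuousLinearMap.adjoint_inner_right]
    exact (Submodule.inner_left_of_mem_orthogonal (Submodule.starProjection_apply_mem U _)
      hk).trans (inner_zero_right _).symm
  · rw [ip_sub_right, sub_eq_zero]
    refine Subtype.ext ?_
    rw [← adjoint_L_comp_L, ← adjoint_L_comp_L, hp', hP z hz]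

end Perp

/-! ### The GNS module of a completely positive map -/

namespace StinespringDilation

open InteriorTensor

variable {A : Type*} [CStarAlgebra A]
variable {H : Type*} [NormedAddCommGroup H] [InnerProductSpace ℂ H] [CompleteSpace H]
variable {B : VonNeumannAlgebra H} {τ : A →ₗ[ℂ] B}
variable {K : Type*} [NormedAddCommGroup K] [InnerProductSpace ℂ K] [CompleteSpace K]
variable (D : StinespringDilation B τ K)
variable {K₂ : Type*} [NormedAddCommGroup K₂] [InnerProductSpace ℂ K₂]

/-- The GNS module of `τ`: the operators `X : H → K` with `V⋆ π(a) X ∈ B` for all `a`. It is the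
strong closure of `span π(A) V B`, on which `X b = X ∘ b` and `⟨X, Y⟩ = X⋆ Y`. -/
def gnsModule : Submodule ℂ (H →L[ℂ] K) where
  carrier := {X | ∀ a, D.V† ∘L D.π a ∘L X ∈ B}
  zero_mem' a := by simp
  add_mem' hX hY a := by
    simp only [ContinuousLinearMap.comp_add]
    exact add_mem (hX a) (hY a)
  smul_mem' c X hX a := by
    simp only [ContinuousLinearMap.comp_smul]
    exact B.toStarSubalgebra.smul_mem (hX a) c

variable {D} in
theorem mem_gnsModule {X : H →L[ℂ] K} : X ∈ D.gnsModule ↔ ∀ a, D.V† ∘L D.π a ∘L X ∈ B := Iff.rfl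

theorem adjoint_π_comp_V (a : A) : (D.π a ∘L D.V)† = D.V† ∘L D.π (star a) := by
  rw [ContinuousLinearMap.adjoint_comp, StarHomClass.map_star, ContinuousLinearMap.star_eq_adjoint]

theorem adjoint_π (a : A) : (D.π a)† = D.π (star a) := by
  rw [StarHomClass.map_star, ContinuousLinearMap.star_eq_adjoint]

theorem π_comp_π (a b : A) : D.π a ∘L D.π b = D.π (a * b) := (_root_.map_mul D.π a b).symm

theorem π_one : D.π 1 = ContinuousLinearMap.id ℂ K := _root_.map_one D.π

/-- Elements of the GNS module are strong limits of elements of `span π(A) V B`; a strongly closed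
space `M` which contains `W π(a) V b` for all `a` and `b` therefore contains `W X`. -/
theorem comp_mem_of_mem_gnsModule {X : H →L[ℂ] K} (hX : X ∈ D.gnsModule) (W : K →L[ℂ] K₂)
    (M : Submodule ℂ (H →L[ℂ] K₂)) (hM : IsClosed (sot '' (M : Set (H →L[ℂ] K₂))))
    (h : ∀ a, ∀ b ∈ B, (W ∘L D.π a ∘L D.V) ∘L b ∈ M) : W ∘L X ∈ M := by
  have h1 : sot X ∈ closure (sot '' (Submodule.span ℂ
      {X | ∃ a : A, ∃ b ∈ B, X = (D.π a ∘L D.V) ∘L b} : Set (H →L[ℂ] K))) := by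
    refine sot_mem_closure_span B (fun a => D.π a ∘L D.V) (fun a a' => ?_) (Y := X)
      (fun a => ?_) (fun a => rfl) fun z hz x => ?_
    · rw [adjoint_π_comp_V, ContinuousLinearMap.comp_assoc, ← ContinuousLinearMap.comp_assoc
        (D.π (star a)), π_comp_π, D.adjoint_comp]
      exact Subtype.property _
    · rw [adjoint_π_comp_V, ContinuousLinearMap.comp_assoc]
      exact hX _
    · have : z = 0 := eq_of_total D.total fun p => by
        rw [inner_zero_right]
        change inner ℂ ((D.π p.1 ∘L D.V) p.2) z = 0
        rw [← ContinuousLinearMap.adjoint_inner_right, hz, inner_zero_right]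
      rw [this, inner_zero_left]
  have h2 : Set.MapsTo (PointwiseConvergenceCLM.postcomp H W) (sot '' (Submodule.span ℂ
      {X | ∃ a : A, ∃ b ∈ B, X = (D.π a ∘L D.V) ∘L b} : Set (H →L[ℂ] K)))
      (sot '' (M : Set (H →L[ℂ] K₂))) := by
    rintro _ ⟨X, hX, rfl⟩
    refine ⟨W ∘L X, ?_, rfl⟩
    have : Submodule.span ℂ {X | ∃ a : A, ∃ b ∈ B, X = (D.π a ∘L D.V) ∘L b} ≤
        M.comap ((ContinuousLinearMap.compL ℂ H K K₂) W).toLinearMap := by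
      refine Submodule.span_le.mpr ?_
      rintro _ ⟨a, b, hb, rfl⟩
      exact h a b hb
    exact this hX
  have h3 := h2.closure (PointwiseConvergenceCLM.postcomp H W).continuous h1
  rw [hM.closure_eq] at h3
  obtain ⟨Y, hY, hYX⟩ := h3
  have : Y = W ∘L X := hYX
  exact this ▸ hY

theorem adjoint_comp_mem {X Y : H →L[ℂ] K} (hX : X ∈ D.gnsModule) (hY : Y ∈ D.gnsModule) :
    X† ∘L Y ∈ B := by
  refine D.comp_mem_of_mem_gnsModule hY (X†) (Subalgebra.toSubmodule B.toSubalgebra)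
    B.isClosed_sot fun a b hb => ?_
  have h1 : X† ∘L D.π a ∘L D.V = star (D.V† ∘L D.π (star a) ∘L X) := by
    rw [ContinuousLinearMap.star_eq_adjoint, ContinuousLinearMap.adjoint_comp,
      ContinuousLinearMap.adjoint_comp, adjoint_π, star_star, ContinuousLinearMap.adjoint_adjoint,
      ContinuousLinearMap.comp_assoc]
  rw [h1]
  exact (mul_mem (star_mem (hX _)) hb : _ ∈ B)

theorem comp_mem_gnsModule {X : H →L[ℂ] K} (hX : X ∈ D.gnsModule) {b : H →L[ℂ] H} (hb : b ∈ B) :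
    X ∘L b ∈ D.gnsModule := fun a => mul_mem (hX a) hb

instance : Module Bᵐᵒᵖ D.gnsModule where
  smul b X := ⟨X.1 ∘L (unop b : B), D.comp_mem_gnsModule X.2 (unop b).2⟩
  one_smul _ := rfl
  mul_smul _ _ _ := rfl
  smul_zero _ := Subtype.ext (ContinuousLinearMap.zero_comp _)
  smul_add _ _ _ := Subtype.ext (ContinuousLinearMap.add_comp _ _ _)
  add_smul _ _ _ := Subtype.ext (ContinuousLinearMap.comp_add _ _ _)
  zero_smul _ := Subtype.ext (ContinuousLinearMap.comp_zero _)

instance : InnerProductModule B D.gnsModule where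
  ip X Y := ⟨X.1† ∘L Y.1, D.adjoint_comp_mem X.2 Y.2⟩
  ip_add_right _ _ _ := Subtype.ext (ContinuousLinearMap.comp_add _ _ _)
  ip_smul_right _ _ _ := Subtype.ext (ContinuousLinearMap.comp_smul _ _ _)
  ip_op_smul_right _ _ _ := rfl
  star_ip X Y := Subtype.ext <| by
    change (X.1† ∘L Y.1)† = Y.1† ∘L X.1
    rw [ContinuousLinearMap.adjoint_comp, ContinuousLinearMap.adjoint_adjoint]
  ip_self_nonneg X := by
    change 0 ≤ X.1† ∘L X.1
    rw [ContinuousLinearMap.nonneg_iff_isPositive]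
    exact ContinuousLinearMap.isPositive_adjoint_comp_self _
  eq_zero_of_ip_self X h := Subtype.ext <| by
    have h1 : X.1† ∘L X.1 = 0 := congrArg Subtype.val h
    have h2 := ContinuousLinearMap.norm_adjoint_comp_self X.1
    rw [h1, norm_zero] at h2
    exact norm_eq_zero.mp (mul_self_eq_zero.mp h2.symm)
  norm_eq X := by
    change ‖X.1‖ = √‖X.1† ∘L X.1‖
    rw [ContinuousLinearMap.norm_adjoint_comp_self, Real.sqrt_mul_self (norm_nonneg _)]

theorem coe_ip (X Y : D.gnsModule) :
    (ip B X Y : H →L[ℂ] H) = (X : H →L[ℂ] K)† ∘L (Y : H →L[ℂ] K) := rfl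

theorem isVonNeumannModule_gnsModule : IsVonNeumannModule B D.gnsModule := by
  refine isVonNeumannModule_of_isClosed B (fun X : D.gnsModule => (X : H →L[ℂ] K))
    (fun _ _ => rfl) ?_
  have h : (sot '' Set.range fun X : D.gnsModule => (X : H →L[ℂ] K)) =
      ⋂ a, PointwiseConvergenceCLM.postcomp H (D.V† ∘L D.π a) ⁻¹'
        (sot '' (B : Set (H →L[ℂ] H))) := by
    ext X
    simp only [Set.mem_iInter]
    constructor
    · rintro ⟨_, ⟨X, rfl⟩, rfl⟩ a
      exact ⟨_, X.2 a, rfl⟩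
    · intro hX
      refine ⟨_, ⟨⟨X, fun a => ?_⟩, rfl⟩, rfl⟩
      obtain ⟨Y, hY, hYX⟩ := hX a
      have : Y = D.V† ∘L D.π a ∘L X := hYX
      exact this ▸ hY
  rw [h]
  exact isClosed_iInter fun a => B.isClosed_sot.preimage
    (PointwiseConvergenceCLM.postcomp H (D.V† ∘L D.π a)).continuous

/-- The representation of `A` on the GNS module by left multiplication with `π(a)`. -/
def gnsRep : A →⋆ₐ[ℂ] Adjointable B D.gnsModule D.gnsModule where
  toFun a :=
    { toFun X := ⟨D.π a ∘L X.1, fun a' => by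
        rw [← ContinuousLinearMap.comp_assoc (D.π a'), π_comp_π]; exact X.2 _⟩
      adj X := ⟨D.π (star a) ∘L X.1, fun a' => by
        rw [← ContinuousLinearMap.comp_assoc (D.π a'), π_comp_π]; exact X.2 _⟩
      ip_adj X Y := Subtype.ext <| by
        rw [coe_ip, coe_ip, ContinuousLinearMap.adjoint_comp, adjoint_π,
          ContinuousLinearMap.comp_assoc] }
  map_one' := Adjointable.ext fun X => Subtype.ext <| by
    change D.π 1 ∘L X.1 = X.1
    rw [π_one, ContinuousLinearMap.id_comp]
  map_mul' a b := Adjointable.ext fun X => Subtype.ext <| by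
    change D.π (a * b) ∘L X.1 = D.π a ∘L D.π b ∘L X.1
    rw [← ContinuousLinearMap.comp_assoc, π_comp_π]
  map_zero' := Adjointable.ext fun X => Subtype.ext <| by
    change D.π 0 ∘L X.1 = 0
    rw [_root_.map_zero, ContinuousLinearMap.zero_comp]
  map_add' a b := Adjointable.ext fun X => Subtype.ext <| by
    change D.π (a + b) ∘L X.1 = D.π a ∘L X.1 + D.π b ∘L X.1
    rw [_root_.map_add, ContinuousLinearMap.add_comp]
  commutes' c := Adjointable.ext fun X => Subtype.ext <| by
    change D.π (algebraMap ℂ A c) ∘L X.1 = c • X.1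
    rw [AlgHomClass.commutes]
    ext h
    simp [Algebra.algebraMap_eq_smul_one]
  map_star' a := Adjointable.ext fun X => rfl

@[simp] theorem coe_gnsRep_apply (a : A) (X : D.gnsModule) :
    ((D.gnsRep a X : D.gnsModule) : H →L[ℂ] K) = D.π a ∘L (X : H →L[ℂ] K) := rfl

theorem V_comp_mem (b : B) : D.V ∘L (b : H →L[ℂ] H) ∈ D.gnsModule := fun a => by
  rw [← ContinuousLinearMap.comp_assoc, ← ContinuousLinearMap.comp_assoc,
    ContinuousLinearMap.comp_assoc (D.V†), D.adjoint_comp]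
  exact mul_mem (Subtype.property _) b.2

/-- The map `B → F`, `b ↦ V b`, as an adjointable map. -/
def gnsV : Adjointable B B D.gnsModule where
  toFun b := ⟨D.V ∘L (b : H →L[ℂ] H), D.V_comp_mem b⟩
  adj X := ⟨D.V† ∘L X.1, by simpa [π_one] using X.2 1⟩
  ip_adj b X := Subtype.ext <| by
    change (D.V ∘L (b : H →L[ℂ] H))† ∘L X.1 = (b : H →L[ℂ] H)† ∘L D.V† ∘L X.1
    rw [ContinuousLinearMap.adjoint_comp, ContinuousLinearMap.comp_assoc]

@[simp] theorem coe_gnsV_apply (b : B) :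
    ((D.gnsV b : D.gnsModule) : H →L[ℂ] K) = D.V ∘L (b : H →L[ℂ] H) := rfl

@[simp] theorem coe_gnsV_adjoint_apply (X : D.gnsModule) :
    ((D.gnsV.adjoint X : B) : H →L[ℂ] H) = D.V† ∘L (X : H →L[ℂ] K) := rfl

end StinespringDilation

/-! ### Unitary representations on modules -/

section UnitaryRep

variable {B : Type*} [CStarAlgebra B] [PartialOrder B]
variable {F : Type*} [NormedAddCommGroup F] [NormedSpace ℂ F] [Module Bᵐᵒᵖ F]
  [InnerProductModule B F]
variable {G : Type*} [Group G] [TopologicalSpace G]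

/-- A unitary representation from an action `f` of `G` on `F` with `⟨f_t x, y⟩ = ⟨x, f_{t⁻¹} y⟩`. -/
def UnitaryRepOn.ofAction (f : G → F → F) (h1 : ∀ x, f 1 x = x)
    (hmul : ∀ s t x, f (s * t) x = f s (f t x))
    (hip : ∀ t x y, ip B (f t x) y = ip B x (f t⁻¹ y))
    (hc : ∀ x, Continuous fun t => f t x) : UnitaryRepOn B F G where
  toHom :=
    { toFun t := ⟨⟨f t, f t⁻¹, hip t⟩, Unitary.mem_iff.mpr ⟨Adjointable.ext fun x => by
          change f t⁻¹ (f t x) = x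
          rw [← hmul, inv_mul_cancel, h1], Adjointable.ext fun x => by
          change f t (f t⁻¹ x) = x
          rw [← hmul, mul_inv_cancel, h1]⟩⟩
      map_one' := Subtype.ext <| Adjointable.ext h1
      map_mul' s t := Subtype.ext <| Adjointable.ext (hmul s t) }
  continuous_apply := hc

namespace UnitaryRepOn

theorem norm_op_apply (v : UnitaryRepOn B F G) (t : G) (x : F) : ‖v.op t x‖ = ‖x‖ := by
  rw [norm_eq (A := B), norm_eq (A := B) x, Adjointable.ip_apply_left]
  have h : star (v.op t) * v.op t = 1 := (Unitary.mem_iff.mp (v.toHom t).2).1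
  have h' : (v.op t).adj (v.op t x) = x := congrArg (fun S : Adjointable B F F => S x) h
  rw [h']

theorem op_apply_sub (v : UnitaryRepOn B F G) (t : G) (x y : F) :
    v.op t (x - y) = v.op t x - v.op t y :=
  _root_.map_sub (AddMonoidHom.mk' (v.op t) (v.op t).map_add) x y

theorem continuous_op_apply (v : UnitaryRepOn B F G) {p : G → F} (hp : Continuous p) :
    Continuous fun t => v.op t (p t) := by
  rw [continuous_iff_continuousAt]
  intro s
  have h1 : Filter.Tendsto (fun t => v.op t (p t - p s)) (nhds s) (nhds 0) := by
    rw [tendsto_zero_iff_norm_tendsto_zero]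
    simp only [norm_op_apply]
    have : Filter.Tendsto (fun t => ‖p t - p s‖) (nhds s) (nhds ‖p s - p s‖) :=
      (hp.sub continuous_const).norm.tendsto s
    simpa using this
  have h2 : Filter.Tendsto (fun t => v.op t (p s)) (nhds s) (nhds (v.op s (p s))) :=
    (v.continuous_apply (p s)).tendsto s
  have h3 := h1.add h2
  simp only [op_apply_sub, sub_add_cancel, zero_add] at h3
  exact h3

end UnitaryRepOn

end UnitaryRep

/-! ### Unitary implementation of covariances -/

namespace InteriorTensor

variable {H : Type*} [NormedAddCommGroup H] [InnerProductSpace ℂ H] [CompleteSpace H]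
variable (B : VonNeumannAlgebra H)
variable {E : Type*} [NormedAddCommGroup E] [NormedSpace ℂ E] [Module Bᵐᵒᵖ E]
  [InnerProductModule B E]

theorem norm_L (x : E) : ‖L B x‖ = ‖x‖ := by
  rw [norm_eq (A := B) x, ← Real.sqrt_mul_self (norm_nonneg (L B x)),
    ← ContinuousLinearMap.norm_adjoint_comp_self, adjoint_L_comp_L]
  rfl

variable (E) in
/-- `x ↦ L_x` as a linear isometry. -/
def Lᵢ : E →ₗᵢ[ℂ] H →L[ℂ] InteriorTensor B E := ⟨Lₗ B E, norm_L B⟩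

theorem isometry_L : Isometry (L B : E → _) := (Lᵢ B E).isometry

end InteriorTensor

section Equivariance

variable {A : Type*} [CStarAlgebra A]
variable {H : Type*} [NormedAddCommGroup H] [InnerProductSpace ℂ H] [CompleteSpace H]
variable {B : VonNeumannAlgebra H} {τ : A →ₗ[ℂ] B}
variable {K : Type*} [NormedAddCommGroup K] [InnerProductSpace ℂ K] [CompleteSpace K]
variable (D : StinespringDilation B τ K)

namespace StinespringDilation

theorem ext_adjoint {X Y : H →L[ℂ] K}
    (h : ∀ a, D.V† ∘L D.π a ∘L X = D.V† ∘L D.π a ∘L Y) : X = Y := by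
  ext k
  refine eq_of_total D.total fun p => ?_
  change inner ℂ ((D.π p.1 ∘L D.V) p.2) (X k) = inner ℂ ((D.π p.1 ∘L D.V) p.2) (Y k)
  rw [← ContinuousLinearMap.adjoint_inner_right, ← ContinuousLinearMap.adjoint_inner_right,
    adjoint_π_comp_V]
  exact congrArg (fun Z : H →L[ℂ] H => inner ℂ p.2 (Z k)) (h (star p.1))

variable {G : Type*} [Group G] [TopologicalSpace G]

/-- A covariance of `τ` is implemented on a minimal dilation by the unitaries
`π(a) V h ↦ π(α_t a) V u_t h`. -/
theorem exists_implementation (α : CStarDynamicalSystem G A) (u : G →* unitary B)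
    (hτ : ∀ t a, τ (α.action t a) = u t * τ a * star (u t : B)) :
    ∃ v : G → K →L[ℂ] K,
      (∀ t, v t ∘L D.V = D.V ∘L ((u t : B) : H →L[ℂ] H)) ∧
      v 1 = ContinuousLinearMap.id ℂ K ∧ (∀ s t, v (s * t) = v s ∘L v t) ∧
      (∀ t, (v t)† = v t⁻¹) ∧ ∀ t a, v t ∘L D.π a = D.π (α.action t a) ∘L v t := by
  have huu : ∀ t, star (u t : B) * (u t : B) = 1 := fun t => (Unitary.mem_iff.mp (u t).2).1
  have hgram : ∀ t a a', (D.π (α.action t a) ∘L D.V ∘L ((u t : B) : H →L[ℂ] H))† ∘L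
      D.π (α.action t a') ∘L D.V ∘L ((u t : B) : H →L[ℂ] H) =
      (τ (star a * a') : H →L[ℂ] H) := by
    intro t a a'
    have h1 : (D.π (α.action t a) ∘L D.V ∘L ((u t : B) : H →L[ℂ] H))† ∘L
        D.π (α.action t a') ∘L D.V ∘L ((u t : B) : H →L[ℂ] H) =
        ((u t : B) : H →L[ℂ] H)† ∘L (D.V† ∘L D.π (star (α.action t a) * α.action t a') ∘L D.V) ∘L
          ((u t : B) : H →L[ℂ] H) := by
      simp only [ContinuousLinearMap.adjoint_comp, adjoint_π, ← π_comp_π,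
        ContinuousLinearMap.comp_assoc]
    have h2 : star (u t : B) * τ (α.action t (star a * a')) * u t = τ (star a * a') := by
      rw [hτ, mul_assoc, mul_assoc, huu, mul_one, ← mul_assoc, huu, one_mul]
    rw [h1, D.adjoint_comp, ← StarHomClass.map_star, ← _root_.map_mul, ← h2, mul_assoc]
    rfl
  have hex : ∀ t, ∃ v : K →L[ℂ] K, ∀ a, v ∘L D.π a ∘L D.V =
      D.π (α.action t a) ∘L D.V ∘L ((u t : B) : H →L[ℂ] H) := fun t =>
    D.exists_clm _ 1 fun a a' => by rw [hgram, star_one, one_mul, mul_one]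
  choose v hv using hex
  have hone : v 1 = ContinuousLinearMap.id ℂ K := D.clm_ext fun a => by
    rw [hv, _root_.map_one, _root_.map_one]
    rfl
  have hmul : ∀ s t, v (s * t) = v s ∘L v t := fun s t => D.clm_ext fun a => by
    have h1 := congrArg (fun Z : H →L[ℂ] K => Z ∘L ((u t : B) : H →L[ℂ] H))
      (hv s (α.action t a))
    have h2 := congrArg (fun Z : H →L[ℂ] K => v s ∘L Z) (hv t a)
    rw [hv, _root_.map_mul, _root_.map_mul]
    exact (h2.trans h1).symm
  have hiso : ∀ t, (v t)† ∘L v t = ContinuousLinearMap.id ℂ K := fun t => D.clm_ext fun a =>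
    D.ext_adjoint fun a' => by
      have h := hgram t (star a') a
      rw [← hv, ← hv, ContinuousLinearMap.adjoint_comp, adjoint_π_comp_V, star_star] at h
      simp only [ContinuousLinearMap.comp_assoc] at h ⊢
      rw [h, ContinuousLinearMap.id_comp, ← ContinuousLinearMap.comp_assoc (D.π a'),
        π_comp_π, D.adjoint_comp]
  refine ⟨v, fun t => ?_, hone, hmul, fun t => ?_, fun t a => D.clm_ext fun a' => ?_⟩
  · have h := hv t 1
    rwa [_root_.map_one (α.action t), π_one, ContinuousLinearMap.id_comp,
      ContinuousLinearMap.id_comp] at h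
  · rw [← ContinuousLinearMap.comp_id ((v t)†), ← hone, ← mul_inv_cancel t, hmul,
      ← ContinuousLinearMap.comp_assoc, hiso, ContinuousLinearMap.id_comp]
  · rw [ContinuousLinearMap.comp_assoc, ContinuousLinearMap.comp_assoc, hv,
      ← ContinuousLinearMap.comp_assoc (D.π a), π_comp_π, hv,
      ← ContinuousLinearMap.comp_assoc (D.π _) (D.π _), π_comp_π, _root_.map_mul]

end StinespringDilation

end Equivariance

/-! ### Quasi-representations from `τ`-maps -/

section TauMap

open InteriorTensor

variable {A : Type*} [CStarAlgebra A]
variable {H : Type*} [NormedAddCommGroup H] [InnerProductSpace ℂ H] [CompleteSpace H]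
variable {B : VonNeumannAlgebra H} {τ : A →ₗ[ℂ] B}
variable {K : Type*} [NormedAddCommGroup K] [InnerProductSpace ℂ K] [CompleteSpace K]
variable (D : StinespringDilation B τ K)
variable {E : Type*}
variable {E' : Type*} [NormedAddCommGroup E'] [NormedSpace ℂ E'] [Module Bᵐᵒᵖ E']
  [InnerProductModule B E']
variable {T : E → E'}

/-- The von Neumann submodule generated by the range of `T`, as a biorthogonal complement. -/
abbrev rangeModule (B : VonNeumannAlgebra H) [Module Bᵐᵒᵖ E'] [InnerProductModule B E']
    (T : E → E') : Submodule ℂ E' :=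
  modulePerp B (modulePerp B (Set.range T) : Set E')

/-- Elements of the generated submodule are separated by inner products with the range of `T`. -/
theorem eq_of_mem_rangeModule {y y' : E'} (hy : y ∈ rangeModule B T) (hy' : y' ∈ rangeModule B T)
    (h : ∀ x, ip B (T x) y = ip B (T x) y') : y = y' := by
  refine sub_eq_zero.mp (eq_zero_of_ip_self (A := B) _ ?_)
  refine sub_mem hy hy' _ ?_
  rintro _ ⟨x, rfl⟩
  rw [ip_sub_right, h, sub_self]

/-- The operators `π(a) V h ↦ T(x a) ⊙ h` from `K` to `E' ⊙ H` which implement a `τ`-map. -/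
theorem IsTauMap.exists_implementation [PartialOrder A] [StarOrderedRing A]
    {E : Type*} [NormedAddCommGroup E] [NormedSpace ℂ E] [Module Aᵐᵒᵖ E] [InnerProductModule A E]
    {T : E → E'} (hT : IsTauMap τ T) :
    ∃ W : E → K →L[ℂ] InteriorTensor B E',
      (∀ x a, W x ∘L D.π a ∘L D.V = L B (T (op a • x))) ∧
      ∀ x y, (W x)† ∘L W y = D.π (ip A x y) := by
  have hex : ∀ x, ∃ W : K →L[ℂ] InteriorTensor B E',
      ∀ a, W ∘L D.π a ∘L D.V = L B (T (op a • x)) := by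
    intro x
    obtain ⟨d, hd⟩ := CStarAlgebra.nonneg_iff_eq_star_mul_self.mp (ip_self_nonneg (A := A) x)
    refine D.exists_clm _ d fun a a' => ?_
    rw [adjoint_L_comp_L, hT, ip_op_smul_right, ip_op_smul_left, hd]
  choose W hW using hex
  refine ⟨W, hW, fun x y => D.clm_ext fun a => D.ext_adjoint fun a' => ?_⟩
  have h : (L B (T (op (star a') • x)))† ∘L L B (T (op a • y)) =
      (τ (a' * ip A x y * a) : H →L[ℂ] H) := by
    rw [adjoint_L_comp_L, hT, ip_op_smul_right, ip_op_smul_left, star_star]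
  rw [← hW, ← hW, ContinuousLinearMap.adjoint_comp, D.adjoint_π_comp_V, star_star,
    ← D.adjoint_comp, ← D.π_comp_π, ← D.π_comp_π] at h
  exact h

variable [AddCommGroup E] [Module Aᵐᵒᵖ E]

theorem exists_L_eq_comp {W : E → K →L[ℂ] InteriorTensor B E'}
    (hW : ∀ x a, W x ∘L D.π a ∘L D.V = L B (T (op a • x)))
    (hE' : IsVonNeumannModule B E') (x : E) (X : D.gnsModule) :
    ∃ y ∈ rangeModule B T, L B y = W x ∘L (X : H →L[ℂ] K) := by
  have hmem := D.comp_mem_of_mem_gnsModule X.2 (W x) (LinearMap.range (Lₗ B E')) hE'.isClosed_sot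
    fun a b hb => by
      refine ⟨op (⟨b, hb⟩ : B) • T (op a • x), ?_⟩
      rw [Lₗ_apply, L_op_smul, hW]
  obtain ⟨y, hy⟩ := hmem
  refine ⟨y, fun z hz => Subtype.ext ?_, hy⟩
  have h0 : (L B z)† ∘L W x = 0 := D.clm_ext fun a => by
    rw [ContinuousLinearMap.comp_assoc, hW, adjoint_L_comp_L, ← star_ip, hz _ ⟨_, rfl⟩, star_zero,
      ContinuousLinearMap.zero_comp]
    rfl
  rw [← adjoint_L_comp_L, ← Lₗ_apply, ← Lₗ_apply, hy, ← ContinuousLinearMap.comp_assoc,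
    Lₗ_apply, h0, ContinuousLinearMap.zero_comp]
  rfl

theorem adjoint_comp_L_mem {W : E → K →L[ℂ] InteriorTensor B E'}
    (hW : ∀ x a, W x ∘L D.π a ∘L D.V = L B (T (op a • x)))
    (x : E) (y : E') : (W x)† ∘L L B y ∈ D.gnsModule := fun a => by
  have h : D.V† ∘L D.π a ∘L (W x)† ∘L L B y = (L B (T (op (star a) • x)))† ∘L L B y := by
    rw [← hW, ContinuousLinearMap.adjoint_comp, D.adjoint_π_comp_V, star_star]
    rfl
  rw [h, adjoint_L_comp_L]
  exact Subtype.property _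

/-- Given the implementing operators `W x` of a `τ`-map, the quasi-representation
`Ψ(x) : X ↦ W x ∘ X` of `E`. -/
theorem exists_quasiRep (hE' : IsVonNeumannModule B E') {W : E → K →L[ℂ] InteriorTensor B E'}
    (hW : ∀ x a, W x ∘L D.π a ∘L D.V = L B (T (op a • x))) :
    ∃ Ψ : E → Adjointable B D.gnsModule (rangeModule B T),
      ∀ x X, L B (Ψ x X : E') = W x ∘L (X : H →L[ℂ] K) := by
  choose f hf hfW using exists_L_eq_comp D hW hE'
  refine ⟨fun x => ⟨fun X => ⟨f x X, hf x X⟩,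
    fun y => ⟨(W x)† ∘L L B (y : E'), adjoint_comp_L_mem D hW x y⟩, fun X y => Subtype.ext ?_⟩, hfW⟩
  rw [D.coe_ip, ip_modulePerp, ← adjoint_L_comp_L, hfW, ContinuousLinearMap.adjoint_comp,
    ContinuousLinearMap.comp_assoc]

end TauMap

/-- The coisometry from a von Neumann module onto a biorthogonal complement, with adjoint the
inclusion. -/
theorem IsVonNeumannModule.exists_coisometry {H : Type*} [NormedAddCommGroup H]
    [InnerProductSpace ℂ H] [CompleteSpace H] {B : VonNeumannAlgebra H}
    {E : Type*} [NormedAddCommGroup E] [NormedSpace ℂ E] [Module Bᵐᵒᵖ E] [InnerProductModule B E]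
    (hE : IsVonNeumannModule B E) (Z : Set E) :
    ∃ S : Adjointable B E (modulePerp B (modulePerp B Z : Set E)), IsCoisometry S ∧
      (∀ y, (S.adjoint y : E) = y) ∧ ∀ y, y - S y ∈ modulePerp B Z := by
  choose p hp hp' using hE.exists_sub_mem_modulePerp Z
  refine ⟨⟨fun y => ⟨p y, hp y⟩, fun y => y, fun x y => ?_⟩, ?_, fun y => rfl, hp'⟩
  · have h : ip B (x - p x) (y : E) = 0 := y.2 _ (hp' x)
    rw [ip_modulePerp, ← sub_eq_zero, ← neg_eq_zero, neg_sub]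
    rwa [← star_ip, ip_sub_right, star_sub, star_ip, star_ip] at h
  · refine Adjointable.ext fun y => Subtype.ext ?_
    have h : p y - (y : E) = 0 := by
      have h1 : (y : E) - p y ∈ modulePerp B (modulePerp B Z : Set E) := sub_mem y.2 (hp y)
      have h2 := eq_zero_of_ip_self (A := B) _ (h1 _ (hp' y))
      rw [← neg_sub, h2, neg_zero]
    exact sub_eq_zero.mp h

/-! ### Covariant `τ`-maps -/

theorem IsFull.mem_of_isClosed {A E : Type*} [CStarAlgebra A] [PartialOrder A]
    [NormedAddCommGroup E] [NormedSpace ℂ E] [Module Aᵐᵒᵖ E] [InnerProductModule A E]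
    (hE : IsFull A E) {M : Submodule ℂ A} (hM : IsClosed (M : Set A))
    (h : ∀ x y : E, ip A x y ∈ M) (a : A) : a ∈ M := by
  have h1 : Submodule.span ℂ {a : A | ∃ x y : E, a = ip A x y} ≤ M :=
    Submodule.span_le.mpr (by rintro _ ⟨x, y, rfl⟩; exact h x y)
  exact closure_minimal h1 hM (hE.symm ▸ Set.mem_univ a)

section CovariantTauMap

variable {H : Type*} [NormedAddCommGroup H] [InnerProductSpace ℂ H] [CompleteSpace H]
variable {B : VonNeumannAlgebra H}
variable {E : Type*} {E' : Type*} [NormedAddCommGroup E'] [NormedSpace ℂ E'] [Module Bᵐᵒᵖ E']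
  [InnerProductModule B E'] {T : E → E'}
variable {G : Type*} [Group G] {u : G →* unitary B} {σ : G → E → E} {R : G → E' → E'}

theorem apply_mem_modulePerp_range
    (hR : ∀ t y z, ip B (R t y) z = ip B y (R t⁻¹ z))
    (hRT : ∀ t x, R t (T x) = op (u t : B) • T (σ t x)) (t : G) {z : E'}
    (hz : z ∈ modulePerp B (Set.range T)) : R t z ∈ modulePerp B (Set.range T) := by
  rintro _ ⟨x, rfl⟩
  have h := hR t⁻¹ (T x) z
  rw [inv_inv, hRT, ip_op_smul_left, hz _ ⟨_, rfl⟩, mul_zero] at h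
  exact h.symm

theorem apply_mem_rangeModule
    (hR : ∀ t y z, ip B (R t y) z = ip B y (R t⁻¹ z))
    (hRT : ∀ t x, R t (T x) = op (u t : B) • T (σ t x)) (t : G) {y : E'}
    (hy : y ∈ rangeModule B T) : R t y ∈ rangeModule B T := by
  intro z hz
  have h := hR t⁻¹ z y
  rw [inv_inv, hy _ (apply_mem_modulePerp_range hR hRT t⁻¹ hz)] at h
  exact h.symm

/-- The unitary representation on the module generated by the range of a covariant `τ`-map, obtained
by restricting `R`. On all of `E'`, `R 1` may be a proper projection. -/
def rangeModuleRep [TopologicalSpace G]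
    (hR : ∀ t y z, ip B (R t y) z = ip B y (R t⁻¹ z))
    (hRT : ∀ t x, R t (T x) = op (u t : B) • T (σ t x))
    (hσ : ∀ x, σ 1 x = x) (hmul : ∀ s t y, R (s * t) y = R s (R t y))
    (hc : ∀ y, Continuous fun t => R t y) : UnitaryRepOn B (rangeModule B T) G :=
  UnitaryRepOn.ofAction (fun t y => ⟨R t y, apply_mem_rangeModule hR hRT t y.2⟩)
    (fun y => Subtype.ext <| eq_of_mem_rangeModule (apply_mem_rangeModule hR hRT 1 y.2) y.2
      fun x => by
        have h := hR 1 (T x) y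
        rw [inv_one, hRT, hσ, _root_.map_one] at h
        rw [← h]
        exact congrArg (fun z => ip B z (y : E')) (one_smul Bᵐᵒᵖ (T x)))
    (fun s t y => Subtype.ext (hmul s t y)) (fun t x y => hR t x y)
    (fun y => (hc y).subtype_mk _)

end CovariantTauMap

section Main

open InteriorTensor

variable {A : Type*} [CStarAlgebra A] [PartialOrder A] [StarOrderedRing A]
variable {H : Type*} [NormedAddCommGroup H] [InnerProductSpace ℂ H] [CompleteSpace H]
variable {B : VonNeumannAlgebra H} {τ : A →ₗ[ℂ] B}
variable {E : Type*} [NormedAddCommGroup E] [NormedSpace ℂ E] [Module Aᵐᵒᵖ E]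
  [InnerProductModule A E]
variable {E' : Type*} [NormedAddCommGroup E'] [NormedSpace ℂ E'] [Module Bᵐᵒᵖ E']
  [InnerProductModule B E'] {T : E → E'}
variable {G : Type*} [Group G] [TopologicalSpace G] {u : G →* unitary B}

theorem IsCompletelyPositive.continuous (hτ : IsCompletelyPositive τ) : Continuous τ :=
  map_continuous (PositiveLinearMap.mk₀ τ fun _ => hτ.map_nonneg)

/-- A covariant `τ`-map on a full module forces `τ` itself to be covariant. Here `R` need not be
unital on `E'`, but it is on the range of `T`. -/
theorem IsTauMap.map_action (hT : IsTauMap τ T) (hτ : IsCompletelyPositive τ) (hE : IsFull A E)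
    (η : ModuleDynamicalSystem A E G) {R : G → E' → E'}
    (hR : ∀ t y z, ip B (R t y) z = ip B y (R t⁻¹ z))
    (hRT : ∀ t x, R t (T x) = op (u t : B) • T ((η.action t : Equiv.Perm E) x))
    (hmul : ∀ s t y, R (s * t) y = R s (R t y)) (t : G) (a : A) :
    τ ((η.induced hE).action t a) = u t * τ a * star (u t : B) := by
  let f : A →ₗ[ℂ] B := τ ∘ₗ ((η.induced hE).action t : A →⋆ₐ[ℂ] A).toAlgHom.toLinearMap
  let g : A →ₗ[ℂ] B :=
    LinearMap.mulRight ℂ (star (u t : B)) ∘ₗ LinearMap.mulLeft ℂ (u t : B) ∘ₗ τ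
  have hf : Continuous f := hτ.continuous.comp
    (map_continuous ((η.induced hE).action t : A →⋆ₐ[ℂ] A))
  have hg : Continuous g := (continuous_const.mul hτ.continuous).mul continuous_const
  refine hE.mem_of_isClosed (M := LinearMap.eqLocus f g) (isClosed_eq hf hg) (fun x y => ?_) a
  change τ ((η.induced hE).action t (ip A x y)) = u t * τ (ip A x y) * star (u t : B)
  have huu : (u t : B) * star (u t : B) = 1 := (Unitary.mem_iff.mp (u t).2).2
  have h1 : R 1 (T y) = T y := by
    rw [hRT, _root_.map_one, _root_.map_one]
    exact one_smul Bᵐᵒᵖ (T y)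
  have h2 := hR t (T x) (R t (T y))
  rw [← hmul, inv_mul_cancel, h1, hRT, hRT, ip_op_smul_left, ip_op_smul_right, hT, hT,
    ← η.induced_spec hE] at h2
  rw [← h2]
  simp only [← mul_assoc, huu, one_mul]
  rw [mul_assoc, huu, mul_one]

end Main

/-! ### Norm continuity -/

theorem InnerProductModule.ip_sub_left {A E : Type*} [CStarAlgebra A] [PartialOrder A]
    [NormedAddCommGroup E] [NormedSpace ℂ E] [Module Aᵐᵒᵖ E] [InnerProductModule A E]
    (x y z : E) : ip A (x - y) z = ip A x z - ip A y z := by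
  rw [← star_ip, ip_sub_right, star_sub, star_ip, star_ip]

section Continuity

open InteriorTensor

variable {A : Type*} [CStarAlgebra A]
variable {H : Type*} [NormedAddCommGroup H] [InnerProductSpace ℂ H] [CompleteSpace H]
variable {B : VonNeumannAlgebra H} {τ : A →ₗ[ℂ] B}
variable {K : Type*} [NormedAddCommGroup K] [InnerProductSpace ℂ K] [CompleteSpace K]
variable (D : StinespringDilation B τ K)
variable {K₂ : Type*} [NormedAddCommGroup K₂] [InnerProductSpace ℂ K₂] [CompleteSpace K₂]
theorem StinespringDilation.norm_π_le (a : A) : ‖D.π a‖ ≤ ‖a‖ :=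
  NonUnitalStarAlgHom.norm_apply_le D.π a

variable [PartialOrder A]
variable {E : Type*} [NormedAddCommGroup E] [NormedSpace ℂ E] [Module Aᵐᵒᵖ E]
  [InnerProductModule A E]

namespace StinespringDilation

/-- Operators `W x` with `(W x)⋆ (W y) = π⟨x, y⟩` depend contractively on `x`. -/
theorem continuous_of_adjoint_comp {W : E → K →L[ℂ] K₂}
    (hWW : ∀ x y, (W x)† ∘L W y = D.π (ip A x y)) : Continuous W := by
  refine LipschitzWith.continuous (K := 1) (LipschitzWith.of_dist_le_mul fun x y => ?_)
  rw [NNReal.coe_one, one_mul, dist_eq_norm, dist_eq_norm]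
  refine le_of_sq_le_sq ?_ (norm_nonneg _)
  have h1 : (W x - W y)† ∘L (W x - W y) = D.π (ip A (x - y) (x - y)) := by
    rw [LinearIsometryEquiv.map_sub]
    simp only [ip_sub_right, ip_sub_left, _root_.map_sub, ← hWW, ContinuousLinearMap.comp_sub,
      ContinuousLinearMap.sub_comp]
  rw [sq, ← ContinuousLinearMap.norm_adjoint_comp_self, h1, norm_eq (A := A) (x - y),
    Real.sq_sqrt (norm_nonneg _)]
  exact D.norm_π_le _

/-- Norm continuity of `t ↦ Y t` may be tested after applying the operators `W x`: by fullness the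
identity is a norm limit of linear combinations of the `π⟨x, y⟩ = (W x)⋆ (W y)`. -/
theorem continuous_of_continuous_comp {G : Type*} [TopologicalSpace G] (hE : IsFull A E)
    {W : E → K →L[ℂ] K₂} (hWW : ∀ x y, (W x)† ∘L W y = D.π (ip A x y)) {Y : G → H →L[ℂ] K} {C : ℝ}
    (hC : ∀ t, ‖Y t‖ ≤ C) (h : ∀ x, Continuous fun t => W x ∘L Y t) : Continuous Y := by
  let M : Submodule ℂ A :=
    { carrier := {a | Continuous fun t => D.π a ∘L Y t}
      zero_mem' := by
        change Continuous fun t => D.π 0 ∘L Y t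
        simpa using continuous_const
      add_mem' := fun {a b} ha hb => by
        change Continuous fun t => D.π (a + b) ∘L Y t
        simp only [_root_.map_add, ContinuousLinearMap.add_comp]
        exact Continuous.add ha hb
      smul_mem' := fun c a ha => by
        change Continuous fun t => D.π (c • a) ∘L Y t
        simp only [_root_.map_smul, ContinuousLinearMap.smul_comp]
        exact Continuous.const_smul ha c }
  have hM : IsClosed (M : Set A) := by
    refine isClosed_of_closure_subset fun a ha => ?_
    change Continuous fun t => D.π a ∘L Y t
    refine continuous_of_uniform_approx_of_continuous fun U hU => ?_
    obtain ⟨ε, hε, hU⟩ := Metric.mem_uniformity_dist.mp hU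
    have hC' : 0 < |C| + 1 := by positivity
    obtain ⟨b, hb, hab⟩ := Metric.mem_closure_iff.mp ha (ε / (|C| + 1)) (by positivity)
    refine ⟨fun t => D.π b ∘L Y t, hb, fun t => hU ?_⟩
    rw [dist_eq_norm, ← ContinuousLinearMap.sub_comp, ← _root_.map_sub]
    calc ‖D.π (a - b) ∘L Y t‖ ≤ ‖D.π (a - b)‖ * ‖Y t‖ := ContinuousLinearMap.opNorm_comp_le _ _
      _ ≤ ‖a - b‖ * (|C| + 1) := by
          refine mul_le_mul (D.norm_π_le _) ?_ (norm_nonneg _) (norm_nonneg _)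
          linarith [hC t, le_abs_self C]
      _ < ε := by rwa [← dist_eq_norm, ← lt_div_iff₀ hC']
  have h1 : (1 : A) ∈ M := hE.mem_of_isClosed hM (fun x y => by
    change Continuous fun t => D.π (ip A x y) ∘L Y t
    simp only [← hWW, ContinuousLinearMap.comp_assoc]
    exact (ContinuousLinearMap.compL ℂ H K₂ K ((W x)†)).continuous.comp (h y)) 1
  have h2 : Continuous fun t => D.π 1 ∘L Y t := h1
  simpa only [D.π_one, ContinuousLinearMap.id_comp] using h2

end StinespringDilation

end Continuity

/-! ### The action of the group on the GNS module -/

section GnsAction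

variable {A : Type*} [CStarAlgebra A]
variable {H : Type*} [NormedAddCommGroup H] [InnerProductSpace ℂ H] [CompleteSpace H]
variable {B : VonNeumannAlgebra H} {τ : A →ₗ[ℂ] B}
variable {K : Type*} [NormedAddCommGroup K] [InnerProductSpace ℂ K] [CompleteSpace K]
variable (D : StinespringDilation B τ K)
variable {G : Type*} [Group G] {u : G →* unitary B} {v : G → K →L[ℂ] K}

namespace StinespringDilation

theorem adjoint_V_comp_implementation
    (hvV : ∀ t, v t ∘L D.V = D.V ∘L ((u t : B) : H →L[ℂ] H)) (hadj : ∀ t, (v t)† = v t⁻¹) (t : G) :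
    D.V† ∘L v t = ((star (u t⁻¹ : B) : B) : H →L[ℂ] H) ∘L D.V† := by
  have h := congrArg ContinuousLinearMap.adjoint (hvV t⁻¹)
  rwa [ContinuousLinearMap.adjoint_comp, ContinuousLinearMap.adjoint_comp, hadj, inv_inv] at h

theorem implementation_comp_mem [TopologicalSpace G] {α : CStarDynamicalSystem G A}
    (hvV : ∀ t, v t ∘L D.V = D.V ∘L ((u t : B) : H →L[ℂ] H)) (hadj : ∀ t, (v t)† = v t⁻¹)
    (hvπ : ∀ t a, v t ∘L D.π a = D.π (α.action t a) ∘L v t) (t : G) {X : H →L[ℂ] K}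
    (hX : X ∈ D.gnsModule) : v t ∘L X ∈ D.gnsModule := fun a => by
  have h1 : α.action t (α.action t⁻¹ a) = a := by
    rw [← StarAlgEquiv.mul_apply, ← _root_.map_mul, mul_inv_cancel, _root_.map_one]
    rfl
  rw [← ContinuousLinearMap.comp_assoc (D.π a), ← h1, ← hvπ, ContinuousLinearMap.comp_assoc,
    ← ContinuousLinearMap.comp_assoc, D.adjoint_V_comp_implementation hvV hadj,
    ContinuousLinearMap.comp_assoc]
  have h2 : D.V† ∘L D.π (α.action t⁻¹ a) ∘L X ∈ B := mem_gnsModule.mp hX _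
  exact mul_mem (star (u t⁻¹ : B)).2 h2

end StinespringDilation

end GnsAction

/-! ### Covariant dilation -/

theorem mainTheorem2
    {A : Type uA} [CStarAlgebra A] [PartialOrder A] [StarOrderedRing A]
    {C : Type uC} [CStarAlgebra C]
    {H : Type uH} [NormedAddCommGroup H] [InnerProductSpace ℂ H] [CompleteSpace H]
    (B : VonNeumannAlgebra H)
    {G : Type uG} [Group G] [TopologicalSpace G] [IsTopologicalGroup G] [LocallyCompactSpace G]
    {E : Type uE} [NormedAddCommGroup E] [NormedSpace ℂ E] [Module Aᵐᵒᵖ E]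
    [InnerProductModule A E] [CompleteSpace E] (hE : IsFull A E)
    (η : ModuleDynamicalSystem A E G)
    {E' : Type uE'} [NormedAddCommGroup E'] [NormedSpace ℂ E'] [Module Bᵐᵒᵖ E']
    [InnerProductModule B E'] (hE' : IsVonNeumannModule B E')
    (ρ : C →⋆ₙₐ[ℂ] Adjointable B E' E')
    (u : G →* unitary B) (hu : ∀ h : H, Continuous fun t => ((u t : B) : H →L[ℂ] H) h)
    (u' : G →* unitary C) (hu' : ∀ y : E', Continuous fun t => ρ (u' t : C) y)
    (τ : A →ₗ[ℂ] B) (hτ : IsCompletelyPositive τ)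
    (T : E → E') (hT : IsTauMap τ T)
    (hcov : ∀ (x : E) (t : G), T ((η.action t : Equiv.Perm E) x) =
      MulOpposite.op (star (u t : B)) • ρ (u' t : C) (T x)) :
    ∃ (F : Type (max uA uH)) (_ : NormedAddCommGroup F) (_ : NormedSpace ℂ F)
      (_ : Module Bᵐᵒᵖ F) (_ : InnerProductModule B F)
      (π : A →⋆ₐ[ℂ] Adjointable B F F) (v : UnitaryRepOn B F G) (V : Adjointable B B F),
      IsVonNeumannModule B F ∧
      IsCovariantRepresentation (η.induced hE) π v ∧
      (∀ (a : A) (b : B), τ a * b = V.adjoint (π a (V b))) ∧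
      (∀ (t : G) (b : B), v.op t (V b) = V ((u t : B) * b)) ∧
      ∃ (F' : Type uE') (_ : NormedAddCommGroup F') (_ : NormedSpace ℂ F')
        (_ : Module Bᵐᵒᵖ F') (_ : InnerProductModule B F')
        (Ψ : E → Adjointable B F F') (w : UnitaryRepOn B F' G) (S : Adjointable B E' F'),
        IsVonNeumannModule B F' ∧
        IsQuasiRepresentation π Ψ ∧
        IsCovariantQuasi η Ψ v w ∧
        IsCoisometry S ∧
        (∀ (x : E) (b : B), MulOpposite.op b • T x = S.adjoint (Ψ x (V b))) ∧
        (∀ (t : G) (y : E'), w.op t (S y) = S (ρ (u' t : C) y)) := by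
  obtain ⟨K, _, _, _, ⟨D⟩⟩ := exists_stinespringDilation hτ
  -- the action of `G` on `E'` through `u'`
  let σ : G → E → E := fun t x => (η.action t : Equiv.Perm E) x
  have hσ1 : ∀ x, σ 1 x = x := fun x => by simp only [σ, _root_.map_one]; rfl
  have hσσ : ∀ t x, σ t (σ t⁻¹ x) = x := fun t x => by
    have h : ((η.action (t * t⁻¹) : Equiv.Perm E)) x = σ t (σ t⁻¹ x) := by
      rw [_root_.map_mul]; rfl
    rw [← h, mul_inv_cancel]
    exact hσ1 x
  let R : G → E' → E' := fun t y => ρ (u' t : C) y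
  have hR : ∀ t y z, ip B (R t y) z = ip B y (R t⁻¹ z) := fun t y z => by
    have h : (u' t⁻¹ : C) = star (u' t : C) := by rw [_root_.map_inv]; rfl
    simp only [R]
    rw [h, map_star ρ, Adjointable.ip_apply_left]
    rfl
  have hRmul : ∀ s t y, R (s * t) y = R s (R t y) := fun s t y => by
    simp only [R, _root_.map_mul, Submonoid.coe_mul]
    rfl
  have hRT : ∀ t x, R t (T x) = op (u t : B) • T (σ t x) := fun t x => by
    have h : star (u t : B) * (u t : B) = 1 := (Unitary.mem_iff.mp (u t).2).1
    simp only [σ]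
    rw [hcov, smul_smul, ← op_mul, h, op_one, one_smul]
  let w : UnitaryRepOn B (rangeModule B T) G := rangeModuleRep hR hRT hσ1 hRmul hu'
  have hτα := hT.map_action hτ hE η hR hRT hRmul
  obtain ⟨v, hvV, hv1, hvmul, hadj, hvπ⟩ := D.exists_implementation (η.induced hE) u hτα
  have hvmem : ∀ t (X : D.gnsModule), v t ∘L (X : H →L[ℂ] K) ∈ D.gnsModule :=
    fun t X => D.implementation_comp_mem hvV hadj hvπ t X.2
  obtain ⟨W, hW, hWW⟩ := hT.exists_implementation D
  obtain ⟨Ψ, hΨ⟩ := exists_quasiRep D hE' hW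
  have hWV : ∀ x, W x ∘L D.V = InteriorTensor.L B (T x) := fun x => by
    have h := hW x 1
    rwa [D.π_one, ContinuousLinearMap.id_comp, op_one, one_smul] at h
  have hTΨ : ∀ z x X, (ip B (T z) (Ψ x X : E') : H →L[ℂ] H) =
      D.V† ∘L D.π (ip A z x) ∘L (X : H →L[ℂ] K) := fun z x X => by
    rw [← InteriorTensor.adjoint_L_comp_L, hΨ, ← hWV, ContinuousLinearMap.adjoint_comp, ← hWW]
    rfl
  -- covariance of `Ψ`, tested against the vectors `T z`, which separate the points of `F'`
  have hΨcov : ∀ t x (X : D.gnsModule), w.op t (Ψ x X) = Ψ (σ t x) ⟨v t ∘L X, hvmem t X⟩ := by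
    intro t x X
    refine Subtype.ext (eq_of_mem_rangeModule (w.op t (Ψ x X)).2 (Subtype.property _) fun z => ?_)
    refine Subtype.ext ?_
    have h1 : ip B (T z) (w.op t (Ψ x X) : E') =
        star (u t⁻¹ : B) * ip B (T (σ t⁻¹ z)) (Ψ x X : E') := by
      have h := hR t⁻¹ (T z) (Ψ x X : E')
      rw [inv_inv, hRT, ip_op_smul_left] at h
      exact h.symm
    have h2 : (η.induced hE).action t (ip A (σ t⁻¹ z) x) = ip A z (σ t x) := by
      rw [η.induced_spec hE]
      exact congrArg (fun y => ip A y (σ t x)) (hσσ t z)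
    rw [h1, hTΨ, ← h2, ← ContinuousLinearMap.comp_assoc (D.π _), ← hvπ,
      ContinuousLinearMap.comp_assoc, ← ContinuousLinearMap.comp_assoc,
      D.adjoint_V_comp_implementation hvV hadj, ContinuousLinearMap.comp_assoc, ← hTΨ]
    rfl
  have hvv : ∀ t (X : H →L[ℂ] K), v t ∘L v t⁻¹ ∘L X = X := fun t X => by
    rw [← ContinuousLinearMap.comp_assoc, ← hvmul, mul_inv_cancel, hv1,
      ContinuousLinearMap.id_comp]
  -- `Ψ(x) v_t X = w_t Ψ(η_{t⁻¹} x) X` is norm continuous in `t`, hence so is `v_t X`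
  have hvcont : ∀ X : D.gnsModule, Continuous fun t => v t ∘L (X : H →L[ℂ] K) := by
    intro X
    refine D.continuous_of_continuous_comp hE hWW (C := ‖(X : H →L[ℂ] K)‖) (fun t => ?_)
      fun x => ?_
    · refine le_of_sq_le_sq ?_ (norm_nonneg _)
      rw [sq, sq, ← ContinuousLinearMap.norm_adjoint_comp_self,
        ← ContinuousLinearMap.norm_adjoint_comp_self, ContinuousLinearMap.adjoint_comp, hadj,
        ContinuousLinearMap.comp_assoc]
      have h := hvv t⁻¹ (X : H →L[ℂ] K)
      rw [inv_inv] at h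
      rw [h]
    · have h1 : ∀ t, W x ∘L v t ∘L (X : H →L[ℂ] K) =
          InteriorTensor.L B (w.op t (Ψ (σ t⁻¹ x) X) : E') := fun t => by
        rw [hΨcov, hσσ, hΨ]
      simp only [h1]
      have h2 : Continuous fun t => Ψ (σ t⁻¹ x) X := by
        refine ((InteriorTensor.isometry_L B (E := E')).comp
          isometry_subtype_coe).isEmbedding.continuous_iff.mpr ?_
        simp only [Function.comp_def, hΨ]
        have h3 : Continuous fun t => W (σ t⁻¹ x) := (D.continuous_of_adjoint_comp hWW).comp
          ((η.continuous_action x).comp continuous_inv)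
        exact ((ContinuousLinearMap.compL ℂ H K (InteriorTensor B E')).flip
          (X : H →L[ℂ] K)).continuous.comp h3
      exact (InteriorTensor.isometry_L B (E := E')).continuous.comp
        (continuous_subtype_val.comp (w.continuous_op_apply h2))
  let vF : UnitaryRepOn B D.gnsModule G :=
    UnitaryRepOn.ofAction (fun t X => ⟨v t ∘L X, hvmem t X⟩)
      (fun X => Subtype.ext
        ((congrArg (fun Z : K →L[ℂ] K => Z ∘L (X : H →L[ℂ] K)) hv1).trans
          (ContinuousLinearMap.id_comp _)))
      (fun s t X => Subtype.ext
        (congrArg (fun Z : K →L[ℂ] K => Z ∘L (X : H →L[ℂ] K)) (hvmul s t)))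
      (fun t X Y => Subtype.ext (by
        rw [D.coe_ip, D.coe_ip, ContinuousLinearMap.adjoint_comp, hadj,
          ContinuousLinearMap.comp_assoc]))
      (fun X => (hvcont X).subtype_mk _)
  obtain ⟨S, hS, hSadj, hSperp⟩ := hE'.exists_coisometry (Set.range T)
  refine ⟨D.gnsModule, inferInstance, inferInstance, inferInstance, inferInstance, D.gnsRep, vF,
    D.gnsV, D.isVonNeumannModule_gnsModule, ?_, ?_, ?_, rangeModule B T, inferInstance,
    inferInstance, inferInstance, inferInstance, Ψ, w, S, isVonNeumannModule_modulePerp hE' _,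
    ?_, ?_, hS, ?_, ?_⟩
  · intro a t
    refine Adjointable.ext fun X => Subtype.ext ?_
    change D.π ((η.induced hE).action t a) ∘L X.1 = v t ∘L D.π a ∘L v t⁻¹ ∘L X.1
    rw [← ContinuousLinearMap.comp_assoc (v t), hvπ, ContinuousLinearMap.comp_assoc, hvv]
  · intro a b
    refine Subtype.ext ?_
    rw [D.coe_gnsV_adjoint_apply, D.coe_gnsRep_apply, D.coe_gnsV_apply,
      ← ContinuousLinearMap.comp_assoc, ← ContinuousLinearMap.comp_assoc,
      ContinuousLinearMap.comp_assoc (D.V†), D.adjoint_comp]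
    rfl
  · intro t b
    refine Subtype.ext ?_
    change v t ∘L D.V ∘L (b : H →L[ℂ] H) = D.V ∘L ((u t : B) : H →L[ℂ] H) ∘L (b : H →L[ℂ] H)
    rw [← ContinuousLinearMap.comp_assoc, hvV, ContinuousLinearMap.comp_assoc]
  · intro x y X Y
    refine Subtype.ext ?_
    rw [ip_modulePerp, ← InteriorTensor.adjoint_L_comp_L, hΨ, hΨ, D.coe_ip, D.coe_gnsRep_apply,
      ContinuousLinearMap.adjoint_comp, ContinuousLinearMap.adjoint_comp, D.adjoint_π, star_ip,
      ← hWW]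
    rfl
  · intro x t
    refine Adjointable.ext fun X => ?_
    change Ψ (σ t x) X = w.op t (Ψ x ⟨v t⁻¹ ∘L X, hvmem t⁻¹ X⟩)
    rw [hΨcov]
    congr 1
    exact Subtype.ext (hvv t X).symm
  · intro x b
    refine InteriorTensor.L_injective B ?_
    rw [hSadj, hΨ, InteriorTensor.L_op_smul, D.coe_gnsV_apply, ← ContinuousLinearMap.comp_assoc,
      hWV]
  · intro t y
    refine Subtype.ext (eq_of_mem_rangeModule (w.op t (S y)).2 (S _).2 fun x => ?_)
    have h1 : ∀ z x, ip B (T x) (S z : E') = ip B (T x) z := fun z x => by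
      have h := hSperp z (T x) ⟨x, rfl⟩
      rw [ip_sub_right, sub_eq_zero] at h
      exact h.symm
    rw [h1]
    have h2 := hR t⁻¹ (T x) (S y : E')
    have h3 := hR t⁻¹ (T x) y
    rw [inv_inv, hRT, ip_op_smul_left] at h2 h3
    rw [h1] at h2
    exact h2.symm.trans h3

end
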